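/- Let $1\le e\le 3$. A (monomial) order ideal is a finite nonempty set $X$ of monomials in finitely many variables that contains every divisor of each of its elements; it is pure if all its maximal elements under divisibility have the same degree. A pure $O$-sequence of socle degree $e$ is a vector $(1,h_1,\dots,h_e)$ for which there is a pure order ideal $X$, with largest degree $e$, containing exactly $h_i$ monomials of degree $i$ for every $0\le i\le e$ (where $h_0=1$; in particular $h_e\ge 1$). For a vector $H=(1,H_1,\dots,H_t)$ of natural numbers put $\Delta H=(1,H_1-1,H_2-H_1,\dots,H_t-H_{t-1})$. Let $h=(1,h_1,\dots,h_e)$ and $h'=(1,h'_1,\dots,h'_{e-1})$ be pure $O$-sequences of socle degrees $e$ and $e-1$ respectively. Suppose that $(\Delta h')_i\le(\Delta h)_i$ for all $0\le i\le\lceil e/2\rceil$ (with $h'_e=0$, which matters only for $e=1$, where the condition at $i=1$ then holds automatically), and that $h'_i\le h_i$ for all $0\le i\le e-1$. Then the shifted sum $$(1,\;h_1+1,\;h_2+h'_1,\;\dots,\;h_e+h'_{e-1})$$ is a pure $O$-sequence of socle degree $e$. -/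

import Mathlib

/-- A monomial `y₁^{a₁} ⋯ y_r^{a_r}` is identified with its exponent vector in `Fin r →₀ ℕ`;
divisibility of monomials is then the order `≤` and the degree is `Finsupp.degree`.
A (monomial) order ideal is a finite nonempty set of monomials closed under taking divisors. -/
structure IsOrderIdeal {r : ℕ} (X : Finset (Fin r →₀ ℕ)) : Prop where
  nonempty : X.Nonempty
  mem_of_dvd : ∀ M ∈ X, ∀ N, N ≤ M → N ∈ X

/-- All maximal monomials of `X` (with respect to divisibility) have the same degree. -/
def IsPure {r : ℕ} (X : Finset (Fin r →₀ ℕ)) : Prop :=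
  ∀ M N, Maximal (· ∈ X) M → Maximal (· ∈ X) N → M.degree = N.degree

/-- The rank vector of `X`: its `i`-th entry is the number of monomials of degree `i` in `X`
(so the entries beyond the largest degree occurring in `X` are `0`). -/
noncomputable def hVector {r : ℕ} (X : Finset (Fin r →₀ ℕ)) (i : ℕ) : ℕ :=
  (X.filter fun M => M.degree = i).card

/-- The socle degree of `X`: the largest degree of a monomial in `X`. -/
noncomputable def socleDegree {r : ℕ} (X : Finset (Fin r →₀ ℕ)) : ℕ :=
  X.sup fun M => M.degree

/-- `(h 0, h 1, …, h e)`, extended by zeros, is a pure `O`-sequence of socle degree `e`: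
the rank vector of a pure order ideal whose largest degree is `e`. -/
def IsPureOSequence (e : ℕ) (h : ℕ → ℕ) : Prop :=
  ∃ (r : ℕ) (X : Finset (Fin r →₀ ℕ)),
    IsOrderIdeal X ∧ IsPure X ∧ socleDegree X = e ∧ ∀ i, h i = hVector X i

/-- The first difference `(H 0, H 1 - H 0, H 2 - H 1, …)`, with integer entries. -/
def firstDifference (H : ℕ → ℕ) : ℕ → ℤ
  | 0 => H 0
  | i + 1 => (H (i + 1) : ℤ) - H i

/-- The shifted sum `(h 0, h 1 + h' 0, h 2 + h' 1, …)`. -/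
def shiftedSum (h h' : ℕ → ℕ) : ℕ → ℕ
  | 0 => h 0
  | i + 1 => h (i + 1) + h' i

/-! Monomials are treated as multisets of variables. If J ⊆ I are pure order ideals of socle degrees
e − 1 and e, and z is a new variable, then I ∪ zJ realises the shifted sum
(`isPureOSequence_shiftedSum`). For e ≤ 2 such a J exists inside any ideal I realising h: it is {1},
or 1 together with h'_1 of the variables of I.

For e = 3 a new ideal is built instead. Let S, Q, T be the variables, quadrics and cubics of an
ideal realising h, and read Q as a graph with loops on S. Put p = h'_1 and q = h'_2, so that p ≤ 2q
and q ≤ C(p+1, 2); the hypotheses say p ≤ |S| and q − p ≤ |Q| − |S|. The new ideals are partial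
cones (`isPureOSequence_cone`): an apex z is joined to itself and to some S' ⊆ S, and the cubics
through z are zK and z²R.

Two facts about (S, Q, T) carry the argument, both from `CubicSystem.growthBounded`: every U ⊆ S
meets at least |U| edges (Hall), and |T| ≤ |Q| + (|Q| − |S|)^{<2}. They are proved together by
enlarging a vertex set: a new vertex creates only cubics over edges inside its neighbourhood, and
`macaulayGrowth_add_le` absorbs these.

Three cases remain. If q ≤ p, all of T is kept and the cone is economical in cubics. If p < q and
|T| + q ≤ |Q| + p, some cubics are deleted, and Hall's condition leaves room to cover the variables
thereby exposed. Otherwise everything is replaced by a full cone over a Macaulay-extremal graph. -/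

/-! ### Order ideals of multisets -/

/-- The multisets of cardinality `n` supported in `S`. -/
def monomialsOn {α : Type*} [DecidableEq α] (S : Finset α) (n : ℕ) : Finset (Multiset α) :=
  (Finset.univ : Finset (Sym S n)).image fun s : Sym S n => (s.1 : Multiset S).map Subtype.val

theorem mem_monomialsOn {α : Type*} [DecidableEq α] {S : Finset α} {n : ℕ} {m : Multiset α} :
    m ∈ monomialsOn S n ↔ m.card = n ∧ ∀ x ∈ m, x ∈ S := by
  simp only [monomialsOn, Finset.mem_image, Finset.mem_univ, true_and]
  constructor
  · rintro ⟨s, rfl⟩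
    refine ⟨by rw [Multiset.card_map]; exact s.2, fun x hx => ?_⟩
    obtain ⟨y, -, rfl⟩ := Multiset.mem_map.1 hx
    exact y.2
  · rintro ⟨hc, hS⟩
    refine ⟨⟨m.attach.map fun x => ⟨x.1, hS x.1 x.2⟩, by simpa using hc⟩, ?_⟩
    simp [Multiset.map_map, Multiset.attach_map_val]

theorem card_monomialsOn {α : Type*} [DecidableEq α] (S : Finset α) (n : ℕ) :
    (monomialsOn S n).card = (S.card).multichoose n := by
  rw [monomialsOn, Finset.card_image_of_injective, Finset.card_univ,
    Sym.card_sym_eq_multichoose, Fintype.card_coe]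
  intro s t h
  exact Subtype.ext (Multiset.map_injective Subtype.val_injective h)

theorem card_monomialsOn_two {α : Type*} [DecidableEq α] (S : Finset α) :
    (monomialsOn S 2).card = (S.card + 1).choose 2 := by
  rw [card_monomialsOn, Nat.multichoose_eq]; rfl

theorem card_monomialsOn_three {α : Type*} [DecidableEq α] (S : Finset α) :
    (monomialsOn S 3).card = (S.card + 2).choose 3 := by
  rw [card_monomialsOn, Nat.multichoose_eq]; rfl

/-- A pure order ideal of socle degree `e`, with monomials written as multisets of variables. -/
structure IsPureIdeal {α : Type*} (e : ℕ) (I : Finset (Multiset α)) : Prop where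
  nonempty : I.Nonempty
  mem_of_le : ∀ m ∈ I, ∀ n ≤ m, n ∈ I
  exists_ge : ∀ m ∈ I, ∃ n ∈ I, m ≤ n ∧ n.card = e

namespace IsPureIdeal

variable {α : Type*} {e : ℕ} {I : Finset (Multiset α)}

theorem card_le (hI : IsPureIdeal e I) {m : Multiset α} (hm : m ∈ I) : m.card ≤ e := by
  obtain ⟨n, -, hmn, rfl⟩ := hI.exists_ge m hm
  exact Multiset.card_le_card hmn

theorem zero_mem (hI : IsPureIdeal e I) : 0 ∈ I := by
  obtain ⟨m, hm⟩ := hI.nonempty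
  exact hI.mem_of_le m hm 0 (Multiset.zero_le m)

end IsPureIdeal

/-- The multiset of (natural numbers naming the) variables of a monomial. -/
noncomputable def toVars {r : ℕ} (M : Fin r →₀ ℕ) : Multiset ℕ :=
  (Finsupp.toMultiset M).map Fin.val

theorem toVars_injective {r : ℕ} : Function.Injective (toVars (r := r)) := fun _ _ h =>
  (Finsupp.orderIsoMultiset (ι := Fin r)).injective (Multiset.map_injective Fin.val_injective h)

theorem toVars_le_iff {r : ℕ} {M N : Fin r →₀ ℕ} : toVars M ≤ toVars N ↔ M ≤ N := by
  rw [toVars, toVars, Multiset.map_le_map_iff Fin.val_injective]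
  exact (Finsupp.orderIsoMultiset (ι := Fin r)).le_iff_le

theorem card_toVars {r : ℕ} (M : Fin r →₀ ℕ) : (toVars M).card = M.degree := by
  rw [toVars, Multiset.card_map, Finsupp.card_toMultiset]; rfl

theorem exists_toVars_eq {r : ℕ} {m : Multiset ℕ} (hm : ∀ x ∈ m, x < r) :
    ∃ M : Fin r →₀ ℕ, toVars M = m := by
  classical
  refine ⟨Multiset.toFinsupp (m.attach.map fun x => (⟨x.1, hm x.1 x.2⟩ : Fin r)), ?_⟩
  rw [toVars, Multiset.toFinsupp_toMultiset]
  simp [Multiset.map_map]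

theorem lt_of_mem_toVars {r : ℕ} {M : Fin r →₀ ℕ} {x : ℕ} (hx : x ∈ toVars M) : x < r := by
  obtain ⟨y, -, rfl⟩ := Multiset.mem_map.1 hx
  exact y.2

theorem IsPureOSequence.exists_pureIdeal {e : ℕ} {h : ℕ → ℕ} (hh : IsPureOSequence e h) :
    ∃ I : Finset (Multiset ℕ), IsPureIdeal e I ∧ ∀ i, h i = (I.filter fun m => m.card = i).card := by
  classical
  obtain ⟨r, X, hX, hpure, rfl, hX'⟩ := hh
  refine ⟨X.image toVars, ⟨hX.nonempty.image _, ?_, ?_⟩, fun i => ?_⟩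
  · intro m hm n hn
    obtain ⟨M, hM, rfl⟩ := Finset.mem_image.1 hm
    obtain ⟨N, rfl⟩ := exists_toVars_eq (r := r) (m := n)
      fun x hx => lt_of_mem_toVars (Multiset.mem_of_le hn hx)
    exact Finset.mem_image_of_mem _ (hX.mem_of_dvd M hM N (toVars_le_iff.1 hn))
  · intro m hm
    obtain ⟨M, hM, rfl⟩ := Finset.mem_image.1 hm
    -- A monomial K of largest degree lies below a maximal K', so by purity every maximal monomial
    -- has the socle degree.
    obtain ⟨K, hK, hKe⟩ := Finset.exists_mem_eq_sup X hX.nonempty fun M => M.degree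
    obtain ⟨K', hKK', hK'⟩ := X.exists_le_maximal hK
    obtain ⟨N, hMN, hN⟩ := X.exists_le_maximal hM
    refine ⟨toVars N, Finset.mem_image_of_mem _ hN.1, toVars_le_iff.2 hMN, ?_⟩
    rw [card_toVars, hpure N K' hN hK']
    refine le_antisymm (Finset.le_sup (f := fun M => Finsupp.degree M) hK'.1) ?_
    rw [socleDegree, hKe]
    exact Finsupp.degree_mono hKK'
  · rw [hX', hVector, Finset.filter_image, Finset.card_image_of_injective _ toVars_injective]
    simp only [card_toVars]

theorem IsPureIdeal.isPureOSequence {e : ℕ} {h : ℕ → ℕ} {I : Finset (Multiset ℕ)}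
    (hI : IsPureIdeal e I) (hh : ∀ i, h i = (I.filter fun m => m.card = i).card) :
    IsPureOSequence e h := by
  classical
  obtain ⟨r, hr⟩ : ∃ r, ∀ m ∈ I, ∀ x ∈ m, x < r := by
    refine ⟨(I.sup fun m => m.toFinset).sup id + 1, fun m hm x hx => Nat.lt_succ_of_le ?_⟩
    refine Finset.le_sup (f := id) (b := x) ?_
    exact Finset.le_sup (f := fun m : Multiset ℕ => m.toFinset) hm (Multiset.mem_toFinset.2 hx)
  set X : Finset (Fin r →₀ ℕ) := I.preimage toVars toVars_injective.injOn with hX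
  have hmem : ∀ M, M ∈ X ↔ toVars M ∈ I := fun M => Finset.mem_preimage
  have hlift : ∀ m ∈ I, ∃ M ∈ X, toVars M = m := fun m hm => by
    obtain ⟨M, rfl⟩ := exists_toVars_eq (hr m hm)
    exact ⟨M, (hmem M).2 hm, rfl⟩
  have hup : ∀ M ∈ X, ∃ N ∈ X, M ≤ N ∧ N.degree = e := fun M hM => by
    obtain ⟨n, hn, hle, hc⟩ := hI.exists_ge _ ((hmem M).1 hM)
    obtain ⟨N, hN, rfl⟩ := hlift n hn
    exact ⟨N, hN, toVars_le_iff.1 hle, by rw [← card_toVars, hc]⟩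
  have hmax : ∀ M, Maximal (· ∈ X) M → M.degree = e := fun M hM => by
    obtain ⟨N, hN, hle, hc⟩ := hup M hM.1
    rw [hM.eq_of_le hN hle, hc]
  obtain ⟨M₀, hM₀, -⟩ := hlift 0 hI.zero_mem
  refine ⟨r, X, ⟨⟨M₀, hM₀⟩, fun M hM N hN => ?_⟩, fun M N hM hN => by rw [hmax M hM, hmax N hN],
    le_antisymm ?_ ?_, fun i => ?_⟩
  · exact (hmem N).2 (hI.mem_of_le _ ((hmem M).1 hM) _ (toVars_le_iff.2 hN))
  · refine Finset.sup_le fun M hM => ?_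
    rw [← card_toVars]
    exact hI.card_le ((hmem M).1 hM)
  · obtain ⟨N, hN, -, hc⟩ := hup M₀ hM₀
    rw [← hc]
    exact Finset.le_sup (f := fun M => Finsupp.degree M) hN
  · rw [hh, hVector, ← Finset.card_image_of_injective _ (toVars_injective (r := r))]
    congr 1
    ext m
    simp only [Finset.mem_filter, Finset.mem_image]
    constructor
    · rintro ⟨hm, rfl⟩
      obtain ⟨M, hM, rfl⟩ := hlift m hm
      exact ⟨M, ⟨hM, (card_toVars M).symm⟩, rfl⟩
    · rintro ⟨M, ⟨hM, rfl⟩, rfl⟩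
      exact ⟨(hmem M).1 hM, card_toVars M⟩

/-- Adjoining `z • J` to an ideal `I`, for a new variable `z` and a subideal `J` of `I`. -/
theorem IsPureIdeal.union_image_cons {α : Type*} [DecidableEq α] {e : ℕ} {I J : Finset (Multiset α)}
    (hI : IsPureIdeal (e + 1) I) (hJ : IsPureIdeal e J) (hJI : J ⊆ I) (z : α) : IsPureIdeal (e + 1) (I ∪ J.image (z ::ₘ ·)) := by
  refine ⟨hI.nonempty.mono Finset.subset_union_left, fun m hm n hn => ?_, fun m hm => ?_⟩
  · rcases Finset.mem_union.1 hm with hm | hm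
    · exact Finset.mem_union_left _ (hI.mem_of_le m hm n hn)
    · obtain ⟨k, hk, rfl⟩ := Finset.mem_image.1 hm
      by_cases hzn : z ∈ n
      · refine Finset.mem_union_right _ (Finset.mem_image.2 ⟨n.erase z, ?_, Multiset.cons_erase hzn⟩)
        exact hJ.mem_of_le k hk _ (Multiset.erase_le_iff_le_cons.2 hn)
      · exact Finset.mem_union_left _
          (hI.mem_of_le k (hJI hk) n ((Multiset.le_cons_of_notMem hzn).1 hn))
  · rcases Finset.mem_union.1 hm with hm | hm
    · obtain ⟨n, hn, h⟩ := hI.exists_ge m hm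
      exact ⟨n, Finset.mem_union_left _ hn, h⟩
    · obtain ⟨k, hk, rfl⟩ := Finset.mem_image.1 hm
      obtain ⟨n, hn, hkn, hc⟩ := hJ.exists_ge k hk
      exact ⟨z ::ₘ n, Finset.mem_union_right _ (Finset.mem_image_of_mem _ hn),
        (Multiset.cons_le_cons_iff z).2 hkn, by simp [hc]⟩

theorem isPureOSequence_shiftedSum {e : ℕ} {h h' : ℕ → ℕ} {I J : Finset (Multiset ℕ)}
    (hI : IsPureIdeal (e + 1) I) (hJ : IsPureIdeal e J) (hJI : J ⊆ I)
    (hh : ∀ i, h i = (I.filter fun m => m.card = i).card)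
    (hh' : ∀ i, h' i = (J.filter fun m => m.card = i).card) :
    IsPureOSequence (e + 1) (shiftedSum h h') := by
  obtain ⟨z, hz⟩ := Infinite.exists_notMem_finset (I.sup fun m => m.toFinset)
  replace hz : ∀ m ∈ I, z ∉ m := fun m hm hzm =>
    hz (Finset.le_sup (f := fun m : Multiset ℕ => m.toFinset) hm (Multiset.mem_toFinset.2 hzm))
  refine (hI.union_image_cons hJ hJI z).isPureOSequence fun i => ?_
  have hdisj : Disjoint I (J.image (z ::ₘ ·)) := Finset.disjoint_left.2 fun m hm hm' => by
    obtain ⟨k, -, rfl⟩ := Finset.mem_image.1 hm'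
    exact hz _ hm (Multiset.mem_cons_self z k)
  rw [Finset.filter_union, Finset.card_union_of_disjoint
    (Finset.disjoint_filter_filter hdisj), Finset.filter_image,
    Finset.card_image_of_injective _ (fun _ _ => (Multiset.cons_inj_right z).1)]
  cases i with
  | zero => simp [shiftedSum, hh]
  | succ i => simp [shiftedSum, hh, hh']

/-! ### Macaulay growth from degree two to degree three -/

theorem choose_succ_two (k : ℕ) : (k + 2).choose 2 = (k + 1).choose 2 + (k + 1) := by
  rw [Nat.choose_succ_succ' (k + 1) 1, Nat.choose_one_right, add_comm]

theorem choose_succ_three (k : ℕ) : (k + 3).choose 3 = (k + 2).choose 3 + (k + 2).choose 2 := by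
  rw [Nat.choose_succ_succ' (k + 2) 2, add_comm]

theorem two_mul_choose_two (k : ℕ) : 2 * (k + 1).choose 2 = k * (k + 1) := by
  induction k with
  | zero => rfl
  | succ k ih => rw [choose_succ_two]; linarith

theorem choose_two_mono {k l : ℕ} (h : k ≤ l) : k.choose 2 ≤ l.choose 2 :=
  Nat.choose_le_choose 2 h

theorem le_choose_two (k : ℕ) : k ≤ (k + 1).choose 2 := by
  induction k with
  | zero => simp
  | succ k ih => rw [choose_succ_two]; omega

/-- The Macaulay bound `m^{<2>}` for the growth from degree two to degree three: if
`m = (k + 1).choose 2 + j` with `j ≤ k + 1`, it is `(k + 2).choose 3 + (j + 1).choose 2`. -/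
def macaulayGrowth (m : ℕ) : ℕ :=
  (Nat.findGreatest (fun k => (k + 1).choose 2 ≤ m) m + 2).choose 3 +
    (m - (Nat.findGreatest (fun k => (k + 1).choose 2 ≤ m) m + 1).choose 2 + 1).choose 2

theorem exists_eq_choose_two_add (m : ℕ) : ∃ k j, j ≤ k ∧ m = (k + 1).choose 2 + j := by
  induction m with
  | zero => exact ⟨0, 0, le_rfl, rfl⟩
  | succ m ih =>
    obtain ⟨k, j, hj, rfl⟩ := ih
    rcases hj.lt_or_eq with h | rfl
    · exact ⟨k, j + 1, h, by omega⟩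
    · exact ⟨j + 1, 0, Nat.zero_le _, by rw [choose_succ_two]; omega⟩

/-- The value j = k + 1 really belongs to the next block, with remainder 0, but Pascal's rule gives
the same formula there. Admitting it avoids a carry at block boundaries. -/
theorem macaulayGrowth_eq {k j : ℕ} (hj : j ≤ k + 1) :
    macaulayGrowth ((k + 1).choose 2 + j) = (k + 2).choose 3 + (j + 1).choose 2 := by
  have key : ∀ k j : ℕ, j ≤ k →
      macaulayGrowth ((k + 1).choose 2 + j) = (k + 2).choose 3 + (j + 1).choose 2 := by
    intro k j hj
    have hk : Nat.findGreatest (fun i => (i + 1).choose 2 ≤ (k + 1).choose 2 + j)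
        ((k + 1).choose 2 + j) = k := by
      refine Nat.findGreatest_eq_iff.2 ⟨le_add_right (le_choose_two k),
        fun _ => Nat.le_add_right _ _, fun n hn _ h => ?_⟩
      have := choose_two_mono (k := k + 2) (l := n + 1) (by omega)
      rw [choose_succ_two] at this
      omega
    rw [macaulayGrowth, hk, Nat.add_sub_cancel_left]
  rcases Nat.lt_or_ge k j with h | h
  · obtain rfl : j = k + 1 := by omega
    rw [← choose_succ_two, ← add_zero ((k + 2).choose 2), key (k + 1) 0 (Nat.zero_le _),
      choose_succ_three]
    simp
  · exact key k j h

/-- A vertex of degree `d` whose link has `x` edges adds at most as many triangles as are added by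
`d` steps of Macaulay growth. -/
theorem macaulayGrowth_add_le {m d x : ℕ} (hx : x ≤ (d + 1).choose 2) (hx' : x ≤ m + d) :
    macaulayGrowth m + x ≤ macaulayGrowth (m + d) := by
  induction d generalizing m with
  | zero => simp at hx; simp [hx]
  | succ d ih =>
    obtain ⟨k, j, hj, hm⟩ := exists_eq_choose_two_add m
    have hfm : macaulayGrowth m = (k + 2).choose 3 + (j + 1).choose 2 := by
      rw [hm, macaulayGrowth_eq (by omega)]
    have hmono : macaulayGrowth m ≤ macaulayGrowth (m + 1) := by
      rw [hfm, hm, add_assoc, macaulayGrowth_eq (by omega)]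
      have := choose_two_mono (k := j + 1) (l := j + 1 + 1) (by omega)
      omega
    -- If x already fits d steps, one step is spent on monotonicity. Otherwise x is large, and `hx'`
    -- forces d ≤ k + 1, so at most one block boundary is crossed.
    by_cases hxd : x ≤ (d + 1).choose 2
    · have := ih (m := m + 1) hxd (by omega)
      rw [show m + (d + 1) = m + 1 + d by ring]
      omega
    have hdk : d ≤ k + 1 := by
      by_contra hlt
      obtain ⟨i, rfl⟩ : ∃ i, d = k + 2 + i := ⟨d - (k + 2), by omega⟩
      have h1 := choose_two_mono (k := k + 2) (l := k + 1 + i + 1) (by omega)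
      have h2 := choose_succ_two (k + 1 + i)
      have h3 := choose_succ_two k
      rw [show k + 1 + i + 2 = k + 2 + i + 1 by ring] at h2
      omega
    have h3 := choose_succ_two k
    have h4 := choose_succ_three k
    have h5 := choose_succ_two d
    rcases Nat.lt_or_ge (k + 1) (j + (d + 1)) with h | h
    · obtain ⟨i, hi⟩ : ∃ i, j + (d + 1) = k + 1 + i := ⟨j + (d + 1) - (k + 1), by omega⟩
      have hi2 : m + (d + 1) = (k + 1 + 1).choose 2 + i := by
        rw [choose_succ_two]; omega
      rw [hi2, macaulayGrowth_eq (by omega), hfm]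
      have e1 := two_mul_choose_two (k + 1)
      have e2 := two_mul_choose_two i
      have e3 := two_mul_choose_two j
      have e4 := two_mul_choose_two (d + 1)
      -- For d = k + 1 the growth increment is exactly m + (d + 1), so `hx'` suffices. Otherwise
      -- convexity of C(·, 2) compares two steps of length s, from i and from j ≥ i.
      rcases Nat.lt_or_ge (k + 1) (d + 1) with hd | hd
      · obtain rfl : d = k + 1 := by omega
        obtain rfl : i = j + 1 := by omega
        have := choose_succ_two j
        simp only [show k + 1 + 2 = k + 3 by ring, show k + 1 + 1 = k + 2 by ring,
          show j + 1 + 1 = j + 2 by ring] at *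
        omega
      · obtain ⟨s, hs⟩ : ∃ s, k + 1 = j + s := ⟨k + 1 - j, by omega⟩
        have hd' : d + 1 = i + s := by omega
        have hij : i ≤ j := by omega
        rw [hs] at e1
        rw [hd'] at e4 hx
        have : i * s ≤ j * s := Nat.mul_le_mul_right s hij
        have : (i + s + 1).choose 2 + (j + 1).choose 2 ≤ (j + s + 1).choose 2 + (i + 1).choose 2 := by
          nlinarith
        rw [← hs] at this
        simp only [show k + 1 + 2 = k + 3 by ring, show k + 1 + 1 = k + 2 by ring] at *
        omega
    · rw [hfm, hm, add_assoc ((k + 1).choose 2), macaulayGrowth_eq h]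
      have e3 := two_mul_choose_two j
      have e4 := two_mul_choose_two (d + 1)
      have e5 := two_mul_choose_two (j + (d + 1))
      nlinarith

theorem macaulayGrowth_mono {m n : ℕ} (h : m ≤ n) : macaulayGrowth m ≤ macaulayGrowth n := by
  obtain ⟨d, rfl⟩ := Nat.exists_eq_add_of_le h
  exact macaulayGrowth_add_le (x := 0) (Nat.zero_le _) (Nat.zero_le _)

/-- The Macaulay bound is attained on any large enough vertex set. -/
theorem exists_macaulay_graph {α : Type*} [DecidableEq α] {S : Finset α} {m : ℕ}
    (hm : m ≤ (S.card + 1).choose 2) :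
    ∃ F ⊆ monomialsOn S 2, ∃ T : Finset (Multiset α), F.card = m ∧ T.card = macaulayGrowth m ∧
      (∀ t ∈ T, t.card = 3) ∧ ∀ x m, x ::ₘ m ∈ T → m ∈ F := by
  obtain ⟨k, j, hj, rfl⟩ := exists_eq_choose_two_add m
  have hkS : k ≤ S.card := by
    by_contra hlt
    have := choose_two_mono (k := S.card + 2) (l := k + 1) (by omega)
    rw [choose_succ_two] at this
    omega
  obtain ⟨A, hAS, hA⟩ := Finset.exists_subset_card_eq hkS
  obtain ⟨B, hBA, hB⟩ := Finset.exists_subset_card_eq (hj.trans hA.ge)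
  rcases hkS.lt_or_eq with hlt | heq
  · obtain ⟨v, hvS, hvA⟩ := Finset.exists_mem_notMem_of_card_lt_card (hA.trans_lt hlt)
    -- Extremal graph: all quadrics on the k variables A, and one more vertex v joined to the j
    -- variables B. The cubics through v are v times the quadrics on B.
    refine ⟨monomialsOn A 2 ∪ (monomialsOn B 1).image (v ::ₘ ·), ?_,
      monomialsOn A 3 ∪ (monomialsOn B 2).image (v ::ₘ ·), ?_, ?_, ?_, ?_⟩
    · intro m hm
      simp only [Finset.mem_union, Finset.mem_image, mem_monomialsOn] at hm ⊢
      rcases hm with ⟨h1, h2⟩ | ⟨n, ⟨h1, h2⟩, rfl⟩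
      · exact ⟨h1, fun x hx => hAS (h2 x hx)⟩
      · refine ⟨by simp [h1], fun x hx => ?_⟩
        rcases Multiset.mem_cons.1 hx with rfl | hx
        exacts [hvS, hAS (hBA (h2 x hx))]
    · rw [Finset.card_union_of_disjoint, card_monomialsOn_two, Finset.card_image_of_injective _
        fun _ _ => (Multiset.cons_inj_right v).1, card_monomialsOn, Nat.multichoose_one_right, hA, hB]
      refine Finset.disjoint_left.2 fun m hm hm' => ?_
      obtain ⟨n, -, rfl⟩ := Finset.mem_image.1 hm'
      exact hvA ((mem_monomialsOn.1 hm).2 v (Multiset.mem_cons_self v n))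
    · rw [Finset.card_union_of_disjoint, card_monomialsOn_three, Finset.card_image_of_injective _
        fun _ _ => (Multiset.cons_inj_right v).1, card_monomialsOn_two, hA, hB,
        macaulayGrowth_eq (by omega)]
      refine Finset.disjoint_left.2 fun m hm hm' => ?_
      obtain ⟨n, -, rfl⟩ := Finset.mem_image.1 hm'
      exact hvA ((mem_monomialsOn.1 hm).2 v (Multiset.mem_cons_self v n))
    · intro t ht
      simp only [Finset.mem_union, Finset.mem_image, mem_monomialsOn] at ht
      rcases ht with ⟨h1, -⟩ | ⟨n, ⟨h1, -⟩, rfl⟩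
      exacts [h1, by simp [h1]]
    · intro x m ht
      simp only [Finset.mem_union, Finset.mem_image, mem_monomialsOn] at ht ⊢
      rcases ht with ⟨h1, h2⟩ | ⟨n, ⟨h1, h2⟩, hn⟩
      · exact Or.inl ⟨by simpa using h1, fun y hy => h2 y (Multiset.mem_cons_of_mem hy)⟩
      · rcases Multiset.cons_eq_cons.1 hn with ⟨rfl, rfl⟩ | ⟨-, c, rfl, rfl⟩
        · exact Or.inl ⟨h1, fun y hy => hBA (h2 y hy)⟩
        · exact Or.inr ⟨c, ⟨by simpa using h1, fun y hy => h2 y (Multiset.mem_cons_of_mem hy)⟩, rfl⟩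
  · obtain rfl : j = 0 := by rw [heq] at hm; omega
    refine ⟨monomialsOn A 2, fun m hm => ?_, monomialsOn A 3, ?_, ?_, fun t ht =>
      (mem_monomialsOn.1 ht).1, fun x m ht => ?_⟩
    · rw [mem_monomialsOn] at hm ⊢
      exact ⟨hm.1, fun x hx => hAS (hm.2 x hx)⟩
    · rw [card_monomialsOn_two, hA, add_zero]
    · rw [card_monomialsOn_three, hA, macaulayGrowth_eq (Nat.zero_le _)]; simp
    · rw [mem_monomialsOn] at ht ⊢
      exact ⟨by simpa using ht.1, fun y hy => ht.2 y (Multiset.mem_cons_of_mem hy)⟩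

/-! ### Pure ideals of socle degree three -/

/-- The variables `S`, the quadrics `Q` and the cubics `T` of a pure order ideal generated in
degree three. -/
structure CubicSystem {α : Type*} (S : Finset α) (Q T : Finset (Multiset α)) : Prop where
  card_cubic : ∀ t ∈ T, t.card = 3
  card_quadric : ∀ m ∈ Q, m.card = 2
  mem_quadrics : ∀ x m, x ::ₘ m ∈ T → m ∈ Q
  mem_vars : ∀ m ∈ Q, ∀ x ∈ m, x ∈ S
  exists_cubic : ∀ m ∈ Q, ∃ x, x ::ₘ m ∈ T
  exists_quadric : ∀ x ∈ S, ∃ m ∈ Q, x ∈ m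

theorem eq_cons_cons_of_card_two {α : Type*} {m : Multiset α} (hm : m.card = 2) {x : α} (hx : x ∈ m) :
    ∃ y, m = x ::ₘ {y} := by
  obtain ⟨n, rfl⟩ := Multiset.exists_cons_of_mem hx
  obtain ⟨y, rfl⟩ := Multiset.card_eq_one.1 (by simpa using hm)
  exact ⟨y, rfl⟩

theorem cons_singleton_comm {α : Type*} (x y : α) : x ::ₘ ({y} : Multiset α) = y ::ₘ {x} :=
  Multiset.pair_comm x y

theorem cons_singleton_injective {α : Type*} (v : α) : Function.Injective fun u : α => v ::ₘ {u} :=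
  fun _ _ h => Multiset.singleton_inj.1 ((Multiset.cons_inj_right v).1 h)

theorem CubicSystem.mem_vars_of_cubic {α : Type*} {S : Finset α} {Q T : Finset (Multiset α)}
    (hQ : CubicSystem S Q T) {t : Multiset α} (ht : t ∈ T) {x : α} (hx : x ∈ t) : x ∈ S := by
  obtain ⟨n, rfl⟩ := Multiset.exists_cons_of_mem hx
  obtain ⟨y, z, rfl⟩ := Multiset.card_eq_two.1 (hQ.card_quadric n (hQ.mem_quadrics x n ht))
  exact hQ.mem_vars (x ::ₘ {z}) (hQ.mem_quadrics y _ (by rw [Multiset.cons_swap]; exact ht)) x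
    (Multiset.mem_cons_self x _)

/-- The members of `Q` supported in `W`. -/
def supportedIn {α : Type*} [DecidableEq α] (Q : Finset (Multiset α)) (W : Finset α) :
    Finset (Multiset α) :=
  Q.filter fun m => ∀ x ∈ m, x ∈ W

/-- The members of `Q` that involve a variable of `U`. -/
def touching {α : Type*} [DecidableEq α] (Q : Finset (Multiset α)) (U : Finset α) :
    Finset (Multiset α) :=
  Q.filter fun m => ¬ ∀ x ∈ m, x ∉ U

/-! ### Hall's condition and the Macaulay bound for cubic systems -/

section

variable {α : Type*} [DecidableEq α]

theorem mem_supportedIn {Q : Finset (Multiset α)} {W : Finset α} {m : Multiset α} :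
    m ∈ supportedIn Q W ↔ m ∈ Q ∧ ∀ x ∈ m, x ∈ W :=
  Finset.mem_filter

theorem mem_touching {Q : Finset (Multiset α)} {U : Finset α} {m : Multiset α} :
    m ∈ touching Q U ↔ m ∈ Q ∧ ∃ x ∈ m, x ∈ U := by
  simp [touching]

theorem touching_subset (Q : Finset (Multiset α)) (U : Finset α) : touching Q U ⊆ Q :=
  Finset.filter_subset _ _

theorem supportedIn_mono (Q : Finset (Multiset α)) {W W' : Finset α} (h : W ⊆ W') :
    supportedIn Q W ⊆ supportedIn Q W' := fun m hm => by
  rw [mem_supportedIn] at hm ⊢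
  exact ⟨hm.1, fun x hx => h (hm.2 x hx)⟩

theorem touching_mono {Q Q' : Finset (Multiset α)} {U U' : Finset α} (hQ : Q ⊆ Q') (h : U ⊆ U') :
    touching Q U ⊆ touching Q' U' := fun m hm => by
  rw [mem_touching] at hm ⊢
  obtain ⟨h1, x, hx, hxU⟩ := hm
  exact ⟨hQ h1, x, hx, h hxU⟩

/-- A vertex set on which the graph `Q` satisfies Hall's condition for choosing distinct incident
edges, and on which the cubics are at most as many as Macaulay growth allows. -/
structure GrowthBounded (Q T : Finset (Multiset α)) (W : Finset α) : Prop where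
  hall : ∀ U ⊆ W, U.card ≤ (touching (supportedIn Q W) U).card
  card_le : (supportedIn T W).card ≤
    (supportedIn Q W).card + macaulayGrowth ((supportedIn Q W).card - W.card)

namespace GrowthBounded

variable {S W : Finset α} {Q T : Finset (Multiset α)}

theorem card_vars_le (hW : GrowthBounded Q T W) : W.card ≤ (supportedIn Q W).card :=
  (hW.hall W subset_rfl).trans (Finset.card_le_card (touching_subset _ _))

/-- Hall's condition for W \ N gives at least |W \ N| edges not contained in N. The result feeds the
second hypothesis of `macaulayGrowth_add_le` when N is the neighbourhood of a new vertex. -/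
theorem card_supportedIn_le (hW : GrowthBounded Q T W) {N : Finset α} (hN : N ⊆ W) :
    (supportedIn Q N).card ≤ (supportedIn Q W).card - W.card + N.card := by
  have h1 := hW.hall (W \ N) Finset.sdiff_subset
  have h2 : Disjoint (supportedIn Q N) (touching (supportedIn Q W) (W \ N)) := by
    refine Finset.disjoint_left.2 fun m hm hm' => ?_
    obtain ⟨-, x, hx, hxN⟩ := mem_touching.1 hm'
    exact (Finset.mem_sdiff.1 hxN).2 ((mem_supportedIn.1 hm).2 x hx)
  have h3 := Finset.card_le_card (Finset.union_subset (supportedIn_mono Q hN)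
    (touching_subset (supportedIn Q W) (W \ N)))
  have h4 := Finset.card_sdiff_add_card_eq_card hN
  rw [Finset.card_union_of_disjoint h2] at h3
  omega

/-- The edge m₀ serves v in Hall's condition. A cubic v·m forces v to be joined to both variables of
m, so the new cubics correspond to edges inside the neighbourhood of v. -/
theorem insert_vertex (hQ : CubicSystem S Q T) (hW : GrowthBounded Q T W) {v : α} (hv : v ∉ W)
    {m₀ : Multiset α} (hm₀ : m₀ ∈ Q) (hvm₀ : v ∈ m₀) (hm₀W : ∀ x ∈ m₀, x ∈ insert v W) :
    GrowthBounded Q T (insert v W) := by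
  have hsub : supportedIn Q W ⊆ supportedIn Q (insert v W) :=
    supportedIn_mono Q (Finset.subset_insert v W)
  refine ⟨fun U hU => ?_, ?_⟩
  · by_cases hvU : v ∈ U
    · have h1 := hW.hall (U.erase v) (Finset.subset_insert_iff.1 hU)
      have h2 : touching (supportedIn Q W) (U.erase v) ⊂ touching (supportedIn Q (insert v W)) U := by
        refine (Finset.ssubset_iff_of_subset (touching_mono hsub (Finset.erase_subset v U))).2
          ⟨m₀, mem_touching.2 ⟨mem_supportedIn.2 ⟨hm₀, hm₀W⟩, v, hvm₀, hvU⟩, fun h => ?_⟩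
        exact hv ((mem_supportedIn.1 (mem_touching.1 h).1).2 v hvm₀)
      have h3 := Finset.card_lt_card h2
      have h4 := Finset.card_erase_add_one hvU
      omega
    · exact (hW.hall U ((Finset.subset_insert_iff_of_notMem hvU).1 hU)).trans
        (Finset.card_le_card (touching_mono hsub subset_rfl))
  · set N' := (insert v W).filter fun u => v ::ₘ {u} ∈ Q with hN'
    set N := N'.erase v with hN
    have hNW : N ⊆ W := fun x hx => (Finset.mem_insert.1 (Finset.mem_filter.1
      (Finset.mem_of_mem_erase hx)).1).resolve_left (Finset.ne_of_mem_erase hx)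
    have hQ' : (supportedIn Q (insert v W)).card = (supportedIn Q W).card + N'.card := by
      rw [← Finset.card_image_of_injective N' (cons_singleton_injective v),
        ← Finset.card_union_of_disjoint]
      · congr 1
        ext m
        simp only [Finset.mem_union, mem_supportedIn, Finset.mem_image, hN', Finset.mem_filter]
        constructor
        · rintro ⟨hm, hmW⟩
          by_cases hvm : v ∈ m
          · obtain ⟨y, rfl⟩ := eq_cons_cons_of_card_two (hQ.card_quadric m hm) hvm
            exact Or.inr ⟨y, ⟨hmW y (by simp), hm⟩, rfl⟩
          · exact Or.inl ⟨hm, fun x hx => (Finset.mem_insert.1 (hmW x hx)).resolve_left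
              fun h => hvm (h ▸ hx)⟩
        · rintro (⟨hm, hmW⟩ | ⟨y, ⟨hy, hyQ⟩, rfl⟩)
          · exact ⟨hm, fun x hx => Finset.mem_insert_of_mem (hmW x hx)⟩
          · refine ⟨hyQ, fun x hx => ?_⟩
            rcases Multiset.mem_cons.1 hx with rfl | hx
            exacts [Finset.mem_insert_self _ _, Multiset.mem_singleton.1 hx ▸ hy]
      · refine Finset.disjoint_left.2 fun m hm hm' => ?_
        obtain ⟨y, -, rfl⟩ := Finset.mem_image.1 hm'
        exact hv ((mem_supportedIn.1 hm).2 v (Multiset.mem_cons_self v _))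
    set E := (supportedIn Q (insert v W)).filter fun m => v ::ₘ m ∈ T with hE
    have hT' : (supportedIn T (insert v W)).card ≤ (supportedIn T W).card + E.card := by
      rw [← Finset.card_image_of_injective E fun _ _ => (Multiset.cons_inj_right v).1]
      refine (Finset.card_le_card fun m hm => ?_).trans (Finset.card_union_le _ _)
      rw [mem_supportedIn] at hm
      obtain ⟨hm, hmW⟩ := hm
      rw [Finset.mem_union, mem_supportedIn, Finset.mem_image]
      by_cases hvm : v ∈ m
      · obtain ⟨n, rfl⟩ := Multiset.exists_cons_of_mem hvm
        exact Or.inr ⟨n, Finset.mem_filter.2 ⟨mem_supportedIn.2 ⟨hQ.mem_quadrics v n hm,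
          fun x hx => hmW x (Multiset.mem_cons_of_mem hx)⟩, hm⟩, rfl⟩
      · exact Or.inl ⟨hm, fun x hx => (Finset.mem_insert.1 (hmW x hx)).resolve_left
          fun h => hvm (h ▸ hx)⟩
    have hEN : ∀ m ∈ E, m ∈ Q ∧ ∀ x ∈ m, x ∈ N' := by
      intro m hm
      obtain ⟨hm, hmT⟩ := Finset.mem_filter.1 hm
      rw [mem_supportedIn] at hm
      refine ⟨hm.1, fun x hx => Finset.mem_filter.2 ⟨hm.2 x hx, ?_⟩⟩
      obtain ⟨y, rfl⟩ := eq_cons_cons_of_card_two (hQ.card_quadric m hm.1) hx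
      rw [cons_singleton_comm, Multiset.cons_swap] at hmT
      exact hQ.mem_quadrics _ _ hmT
    have he₁ : (supportedIn Q N).card ≤ (N.card + 1).choose 2 := by
      rw [← card_monomialsOn_two]
      refine Finset.card_le_card fun m hm => ?_
      rw [mem_supportedIn] at hm
      exact mem_monomialsOn.2 ⟨hQ.card_quadric m hm.1, hm.2⟩
    have he₂ := hW.card_supportedIn_le hNW
    have hWQ := hW.card_vars_le
    have hc := hW.card_le
    rw [Finset.card_insert_of_notMem hv, hQ']
    -- With a loop at v, the at most |N'| cubics divisible by v² are charged to the |N'| new edges,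
    -- and |Q| − |W| rises by |N|, absorbing the edges inside N. Without a loop, |Q| − |W| rises
    -- only by d = |N| − 1, but |N| of the cubics are charged to the new edges, leaving at most
    -- C(d+1, 2).
    by_cases hvN : v ∈ N'
    · have hd := Finset.card_erase_add_one hvN
      rw [← hN] at hd
      have hE' : E.card ≤ (supportedIn Q N).card + N'.card := by
        rw [← Finset.card_image_of_injective N' (cons_singleton_injective v)]
        refine (Finset.card_le_card fun m hm => ?_).trans (Finset.card_union_le _ _)
        obtain ⟨hmQ, hmN⟩ := hEN m hm
        rw [Finset.mem_union, mem_supportedIn, Finset.mem_image]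
        by_cases hvm : v ∈ m
        · obtain ⟨y, rfl⟩ := eq_cons_cons_of_card_two (hQ.card_quadric m hmQ) hvm
          exact Or.inr ⟨y, hmN y (by simp), rfl⟩
        · exact Or.inl ⟨hmQ, fun x hx => Finset.mem_erase.2 ⟨fun h => hvm (h ▸ hx), hmN x hx⟩⟩
      have := macaulayGrowth_add_le he₁ he₂
      rw [show (supportedIn Q W).card + N'.card - (W.card + 1) =
        (supportedIn Q W).card - W.card + N.card by omega]
      omega
    · have hNN : N = N' := Finset.erase_eq_of_notMem hvN
      have hE' : E.card ≤ (supportedIn Q N).card := Finset.card_le_card fun m hm => by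
        rw [mem_supportedIn, hNN]
        exact hEN m hm
      obtain ⟨y, rfl⟩ := eq_cons_cons_of_card_two (hQ.card_quadric m₀ hm₀) hvm₀
      have hpos : 0 < N.card := Finset.card_pos.2 ⟨y, by
        rw [hNN]; exact Finset.mem_filter.2 ⟨hm₀W y (by simp), hm₀⟩⟩
      obtain ⟨d, hd⟩ : ∃ d, N.card = d + 1 := ⟨N.card - 1, by omega⟩
      rw [← hNN]
      rw [hd] at he₁ he₂ ⊢
      have hch := choose_succ_two d
      have := macaulayGrowth_add_le (m := (supportedIn Q W).card - W.card) (d := d)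
        (x := (supportedIn Q N).card - (d + 1))
        (by rw [show d + 1 + 1 = d + 2 by ring] at he₁; omega) (by omega)
      rw [show (supportedIn Q W).card + (d + 1) - (W.card + 1) =
        (supportedIn Q W).card - W.card + d by omega]
      omega

/-- Three new vertices come with at least three new edges, so |Q| − |W| does not drop. Since `hno`
excludes loops outside W and edges leaving W, the triangle is the only new cubic. -/
theorem union_triangle (hQ : CubicSystem S Q T) (hW : GrowthBounded Q T W)
    (hno : ∀ x y, x ∉ W → x ::ₘ {y} ∈ Q → y ∉ W ∧ x ≠ y) {A : Finset α}
    (hA : A.card = 3) (hAT : A.val ∈ T) (hAW : Disjoint W A) : GrowthBounded Q T (W ∪ A) := by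
  have hsub : supportedIn Q W ⊆ supportedIn Q (W ∪ A) := supportedIn_mono Q Finset.subset_union_left
  set f : α → Multiset α := fun x => (A.erase x).val with hf
  have hfQ : ∀ x ∈ A, f x ∈ supportedIn Q (W ∪ A) := fun x hx => mem_supportedIn.2
    ⟨hQ.mem_quadrics x _ (by
      have : x ::ₘ (A.erase x).val = A.val := by
        rw [Finset.erase_val]; exact Multiset.cons_erase hx
      rwa [this]),
      fun y hy => Finset.mem_union_right _ (Finset.mem_of_mem_erase (Finset.mem_def.2 hy))⟩
  have hfinj : Set.InjOn f A := fun x hx y hy h => by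
    by_contra hne
    have h' : A.erase x = A.erase y := Finset.val_injective h
    exact Finset.notMem_erase x A (h' ▸ Finset.mem_erase.2 ⟨hne, hx⟩)
  have hfW : ∀ x ∈ A, f x ∉ supportedIn Q W := fun x hx h => by
    have h2 := Finset.card_erase_of_mem hx
    obtain ⟨y, hy⟩ : (A.erase x).Nonempty := Finset.card_pos.1 (by omega)
    exact Finset.disjoint_left.1 hAW ((mem_supportedIn.1 h).2 y hy) (Finset.mem_of_mem_erase hy)
  refine ⟨fun U hU => ?_, ?_⟩
  · set B := U ∩ A with hB
    have hUc : U.card ≤ (U ∩ W).card + B.card := by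
      refine (Finset.card_le_card fun x hx => ?_).trans (Finset.card_union_le _ _)
      rcases Finset.mem_union.1 (hU hx) with h | h
      · exact Finset.mem_union_left _ (Finset.mem_inter.2 ⟨hx, h⟩)
      · exact Finset.mem_union_right _ (Finset.mem_inter.2 ⟨hx, h⟩)
    have h1 := hW.hall (U ∩ W) Finset.inter_subset_right
    set C := A.filter fun x => ∃ y ∈ A.erase x, y ∈ B with hC
    -- C lists the vertices whose opposite side meets B. A single vertex of B already meets two
    -- sides, and three vertices meet all three.
    have hBC : B.card ≤ C.card := by
      rcases B.eq_empty_or_nonempty with h | ⟨b, hb⟩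
      · simp [h]
      have hbA : b ∈ A := (Finset.mem_inter.1 hb).2
      have hbC : A.erase b ⊆ C := fun x hx => Finset.mem_filter.2 ⟨Finset.mem_of_mem_erase hx, b,
        Finset.mem_erase.2 ⟨(Finset.ne_of_mem_erase hx).symm, hbA⟩, hb⟩
      have h2 := Finset.card_le_card hbC
      rw [Finset.card_erase_of_mem hbA] at h2
      by_cases h3 : B.card ≤ 2
      · omega
      refine Finset.card_le_card fun x hx => Finset.mem_filter.2 ⟨(Finset.mem_inter.1 hx).2, ?_⟩
      obtain ⟨y, hy⟩ : (B.erase x).Nonempty := Finset.card_pos.1 (by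
        rw [Finset.card_erase_of_mem hx]; omega)
      rw [Finset.mem_erase] at hy
      exact ⟨y, Finset.mem_erase.2 ⟨hy.1, (Finset.mem_inter.1 hy.2).2⟩, hy.2⟩
    have h2 : (touching (supportedIn Q W) (U ∩ W)).card + C.card ≤
        (touching (supportedIn Q (W ∪ A)) U).card := by
      rw [← Finset.card_image_of_injOn (hfinj.mono (Finset.coe_subset.2 (Finset.filter_subset _ A))),
        ← Finset.card_union_of_disjoint]
      · refine Finset.card_le_card (Finset.union_subset (touching_mono hsub Finset.inter_subset_left)
          fun m hm => ?_)
        obtain ⟨x, hx, rfl⟩ := Finset.mem_image.1 hm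
        obtain ⟨hxA, y, hy, hyB⟩ := Finset.mem_filter.1 hx
        exact mem_touching.2 ⟨hfQ x hxA, y, hy, (Finset.mem_inter.1 hyB).1⟩
      · refine Finset.disjoint_left.2 fun m hm hm' => ?_
        obtain ⟨x, hx, rfl⟩ := Finset.mem_image.1 hm'
        exact hfW x (Finset.mem_filter.1 hx).1 (mem_touching.1 hm).1
    omega
  · have hQ3 : (supportedIn Q W).card + 3 ≤ (supportedIn Q (W ∪ A)).card := by
      rw [← hA, ← Finset.card_image_of_injOn hfinj, ← Finset.card_union_of_disjoint]
      · refine Finset.card_le_card (Finset.union_subset hsub fun m hm => ?_)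
        obtain ⟨x, hx, rfl⟩ := Finset.mem_image.1 hm
        exact hfQ x hx
      · refine Finset.disjoint_left.2 fun m hm hm' => ?_
        obtain ⟨x, hx, rfl⟩ := Finset.mem_image.1 hm'
        exact hfW x hx hm
    have hT1 : (supportedIn T (W ∪ A)).card ≤ (supportedIn T W).card + 1 := by
      refine (Finset.card_le_card fun t ht => ?_).trans (Finset.card_insert_le A.val _)
      rw [Finset.mem_insert, or_iff_not_imp_right]
      intro htW
      rw [mem_supportedIn] at ht htW
      obtain ⟨htT, htA⟩ := ht
      have : ∃ x ∈ t, x ∉ W := by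
        by_contra! h
        exact htW ⟨htT, h⟩
      obtain ⟨x, hx, hxW⟩ := this
      obtain ⟨n, rfl⟩ := Multiset.exists_cons_of_mem hx
      have hn := hQ.mem_quadrics x n htT
      obtain ⟨y, z, rfl⟩ := Multiset.card_eq_two.1 (hQ.card_quadric n hn)
      have hxz : x ::ₘ {z} ∈ Q := hQ.mem_quadrics y _ (by
        rw [Multiset.cons_swap]; exact htT)
      have hxy : x ::ₘ {y} ∈ Q := hQ.mem_quadrics z _ (by
        rw [Multiset.cons_swap, cons_singleton_comm]; exact htT)
      obtain ⟨hyW, hxy'⟩ := hno x y hxW hxy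
      obtain ⟨hzW, hxz'⟩ := hno x z hxW hxz
      obtain ⟨-, hyz'⟩ := hno y z hyW hn
      have hmem : ∀ w ∈ x ::ₘ {y, z}, w ∉ W → w ∈ A := fun w hw hwW =>
        (Finset.mem_union.1 (htA w hw)).resolve_left hwW
      have heq : ({x, y, z} : Finset α) = A := by
        refine Finset.eq_of_subset_of_card_le ?_ ?_
        · intro w hw
          simp only [Finset.mem_insert, Finset.mem_singleton] at hw
          rcases hw with rfl | rfl | rfl
          exacts [hmem _ (by simp) hxW, hmem _ (by simp) hyW, hmem _ (by simp) hzW]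
        · rw [hA, Finset.card_eq_three.2 ⟨x, y, z, hxy', hxz', hyz', rfl⟩]
      rw [← heq, Finset.insert_val_of_notMem (by simp [hxy', hxz']),
        Finset.insert_val_of_notMem (by simp [hyz'])]
      rfl
    have hWA : (W ∪ A).card = W.card + 3 := by rw [Finset.card_union_of_disjoint hAW, hA]
    have hc := hW.card_le
    have := macaulayGrowth_mono (m := (supportedIn Q W).card - W.card)
      (n := (supportedIn Q (W ∪ A)).card - (W ∪ A).card) (by omega)
    omega

end GrowthBounded

/-- A largest W ⊆ S with these bounds must be S. Otherwise `insert_vertex` and maximality forbid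
loops outside W and edges leaving W, so a cubic through an outside vertex is a squarefree triangle
disjoint from W, and `union_triangle` enlarges W. -/
theorem CubicSystem.growthBounded {S : Finset α} {Q T : Finset (Multiset α)}
    (hQ : CubicSystem S Q T) : GrowthBounded Q T S := by
  have hempty : GrowthBounded Q T ∅ := by
    refine ⟨fun U hU => by simp [Finset.subset_empty.1 hU], ?_⟩
    have : supportedIn T ∅ = ∅ := Finset.eq_empty_of_forall_notMem fun t ht => by
      obtain ⟨htT, ht⟩ := mem_supportedIn.1 ht
      have h0 := Multiset.eq_zero_of_forall_notMem fun x hx => Finset.notMem_empty x (ht x hx)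
      simpa [h0] using hQ.card_cubic t htT
    simp [this]
  classical
  obtain ⟨W, hW, hmax⟩ := Finset.exists_max_image
    (S.powerset.filter fun W => GrowthBounded Q T W) Finset.card
    ⟨∅, Finset.mem_filter.2 ⟨Finset.empty_mem_powerset S, hempty⟩⟩
  simp only [Finset.mem_filter, Finset.mem_powerset] at hW hmax
  obtain ⟨hWS, hW⟩ := hW
  rcases hWS.eq_or_ssubset with rfl | hlt
  · exact hW
  exfalso
  have hnew : ∀ m ∈ Q, ∀ v ∈ m, v ∉ W → ¬ ∀ x ∈ m, x ∈ insert v W := by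
    intro m hm v hvm hv hmW
    have := hmax _ ⟨Finset.insert_subset (hQ.mem_vars m hm v hvm) hWS,
      hW.insert_vertex hQ hv hm hvm hmW⟩
    rw [Finset.card_insert_of_notMem hv] at this
    omega
  have hno : ∀ x y, x ∉ W → x ::ₘ {y} ∈ Q → y ∉ W ∧ x ≠ y := by
    intro x y hx hxy
    have h := hnew _ hxy x (by simp) hx
    by_contra hcon
    refine h fun w hw => ?_
    rcases Multiset.mem_cons.1 hw with rfl | hw
    · exact Finset.mem_insert_self _ _
    · obtain rfl := Multiset.mem_singleton.1 hw
      by_cases hwW : w ∈ W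
      · exact Finset.mem_insert_of_mem hwW
      · have : x = w := by by_contra hne; exact hcon ⟨hwW, hne⟩
        rw [this]; exact Finset.mem_insert_self _ _
  obtain ⟨v, hvS, hvW⟩ := Finset.exists_of_ssubset hlt
  obtain ⟨m, hm, hvm⟩ := hQ.exists_quadric v hvS
  obtain ⟨y, rfl⟩ := eq_cons_cons_of_card_two (hQ.card_quadric m hm) hvm
  obtain ⟨z, hz⟩ := hQ.exists_cubic _ hm
  have hvz : v ::ₘ {z} ∈ Q := hQ.mem_quadrics y _ (by
    rw [cons_singleton_comm v z, Multiset.cons_swap, cons_singleton_comm y v]; exact hz)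
  obtain ⟨hyW, hvy⟩ := hno v y hvW hm
  obtain ⟨hzW, hvz'⟩ := hno v z hvW hvz
  have hyz : y ::ₘ {z} ∈ Q := hQ.mem_quadrics v _ (by
    rw [cons_singleton_comm, Multiset.cons_swap]; exact hz)
  obtain ⟨-, hyz'⟩ := hno y z hyW hyz
  have hAc : ({z, v, y} : Finset α).card = 3 :=
    Finset.card_eq_three.2 ⟨z, v, y, hvz'.symm, hyz'.symm, hvy, rfl⟩
  have hAT : ({z, v, y} : Finset α).val ∈ T := by
    rw [Finset.insert_val_of_notMem (by simp [hvz'.symm, hyz'.symm]),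
        Finset.insert_val_of_notMem (by simp [hvy])]
    exact hz
  have hAW : Disjoint W {z, v, y} := by
    refine Finset.disjoint_right.2 fun w hw => ?_
    simp only [Finset.mem_insert, Finset.mem_singleton] at hw
    rcases hw with rfl | rfl | rfl <;> assumption
  have hAS : ({z, v, y} : Finset α) ⊆ S := by
    intro w hw
    simp only [Finset.mem_insert, Finset.mem_singleton] at hw
    rcases hw with rfl | rfl | rfl
    exacts [hQ.mem_vars _ hvz w (by simp), hvS, hQ.mem_vars _ hm w (by simp)]
  have := hmax _ ⟨Finset.union_subset hWS hAS, hW.union_triangle hQ hno hAc hAT hAW⟩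
  rw [Finset.card_union_of_disjoint hAW, hAc] at this
  omega

theorem CubicSystem.supportedIn_quadrics {S : Finset α} {Q T : Finset (Multiset α)}
    (hQ : CubicSystem S Q T) : supportedIn Q S = Q :=
  Finset.filter_true_of_mem hQ.mem_vars

theorem CubicSystem.card_le_touching {S : Finset α} {Q T : Finset (Multiset α)}
    (hQ : CubicSystem S Q T) {U : Finset α} (hU : U ⊆ S) : U.card ≤ (touching Q U).card := by
  have := hQ.growthBounded.hall U hU
  rwa [hQ.supportedIn_quadrics] at this

theorem CubicSystem.card_cubics_le {S : Finset α} {Q T : Finset (Multiset α)}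
    (hQ : CubicSystem S Q T) : T.card ≤ Q.card + macaulayGrowth (Q.card - S.card) := by
  have h := hQ.growthBounded.card_le
  have hT : supportedIn T S = T :=
    Finset.filter_true_of_mem fun t ht x hx => hQ.mem_vars_of_cubic ht hx
  rwa [hQ.supportedIn_quadrics, hT] at h

end

/-! ### Cubic systems and pure `O`-sequences of socle degree three -/

theorem IsPureIdeal.exists_cubicSystem {I : Finset (Multiset ℕ)} (hI : IsPureIdeal 3 I) :
    ∃ S : Finset ℕ, CubicSystem S (I.filter fun m => m.card = 2) (I.filter fun m => m.card = 3) ∧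
      S.card = (I.filter fun m => m.card = 1).card := by
  have hS : ∀ x, x ∈ I.sup (fun m => m.toFinset) ↔ ∃ m ∈ I, x ∈ m := by
    intro x
    simp [Finset.mem_sup]
  have hcover : ∀ m ∈ I, m.card ≤ 2 → ∃ x, x ::ₘ m ∈ I := by
    intro m hm hc
    obtain ⟨n, hn, hmn, hn3⟩ := hI.exists_ge m hm
    obtain ⟨x, hx⟩ := Multiset.lt_iff_cons_le.1 (hmn.lt_of_ne (by rintro rfl; omega))
    exact ⟨x, hI.mem_of_le n hn _ hx⟩
  refine ⟨I.sup fun m => m.toFinset, ⟨fun t ht => (Finset.mem_filter.1 ht).2,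
    fun m hm => (Finset.mem_filter.1 hm).2, fun x m hm => ?_,
    fun m hm x hx => (hS x).2 ⟨m, (Finset.mem_filter.1 hm).1, hx⟩, fun m hm => ?_,
    fun x hx => ?_⟩, ?_⟩
  · obtain ⟨hm, hc⟩ := Finset.mem_filter.1 hm
    exact Finset.mem_filter.2 ⟨hI.mem_of_le _ hm _ (Multiset.le_cons_self m x), by simpa using hc⟩
  · obtain ⟨hm, hc⟩ := Finset.mem_filter.1 hm
    obtain ⟨x, hx⟩ := hcover m hm hc.le
    exact ⟨x, Finset.mem_filter.2 ⟨hx, by simp [hc]⟩⟩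
  · obtain ⟨m, hm, hxm⟩ := (hS x).1 hx
    obtain ⟨y, hy⟩ := hcover {x} (hI.mem_of_le m hm _ (Multiset.singleton_le.2 hxm)) (by simp)
    exact ⟨_, Finset.mem_filter.2 ⟨hy, by simp⟩, by simp⟩
  · rw [← Finset.card_image_of_injective _ (fun _ _ => Multiset.singleton_inj.1 :
      Function.Injective fun x : ℕ => ({x} : Multiset ℕ))]
    congr 1
    ext m
    simp only [Finset.mem_image, hS, Finset.mem_filter]
    constructor
    · rintro ⟨x, ⟨m, hm, hx⟩, rfl⟩
      exact ⟨hI.mem_of_le m hm _ (Multiset.singleton_le.2 hx), by simp⟩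
    · rintro ⟨hm, hc⟩
      obtain ⟨x, rfl⟩ := Multiset.card_eq_one.1 hc
      exact ⟨x, ⟨_, hm, by simp⟩, rfl⟩

theorem CubicSystem.isPureIdeal {α : Type*} [DecidableEq α] {S : Finset α}
    {Q T : Finset (Multiset α)} (hQ : CubicSystem S Q T) (hT : T.Nonempty) :
    IsPureIdeal 3 (insert 0 (S.image fun x => ({x} : Multiset α)) ∪ (Q ∪ T)) := by
  set I := insert 0 (S.image fun x => ({x} : Multiset α)) ∪ (Q ∪ T) with hIdef
  have h0 : 0 ∈ I := by simp [hIdef]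
  have h1 : ∀ x ∈ S, {x} ∈ I := fun x hx => by
    simp [hIdef, hx]
  have h2 : ∀ m ∈ Q, m ∈ I := fun m hm => by simp [hIdef, hm]
  have h3 : ∀ m ∈ T, m ∈ I := fun m hm => by simp [hIdef, hm]
  have hI : ∀ m, m ∈ I ↔ m = 0 ∨ (∃ x ∈ S, m = {x}) ∨ m ∈ Q ∨ m ∈ T := by
    intro m
    simp only [hIdef, Finset.mem_union, Finset.mem_insert, Finset.mem_image, eq_comm (a := m),
      or_assoc]
  have hdown : ∀ x m, x ::ₘ m ∈ I → m ∈ I := by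
    intro x m hm
    rcases (hI _).1 hm with h | ⟨y, -, h⟩ | h | h
    · simp at h
    · obtain rfl : m = 0 := by
        have := congrArg Multiset.card h
        simpa using this
      exact h0
    · obtain ⟨y, rfl⟩ := Multiset.card_eq_one.1 (by simpa using hQ.card_quadric _ h)
      exact h1 y (hQ.mem_vars _ h y (by simp))
    · exact h2 m (hQ.mem_quadrics x m h)
  have hlow : ∀ k : ℕ, ∀ m ∈ I, ∀ n ≤ m, m.card = n.card + k → n ∈ I := by
    intro k
    induction k with
    | zero => intro m hm n hn hk; rwa [Multiset.eq_of_le_of_card_le hn (by omega)]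
    | succ k ih =>
      intro m hm n hn hk
      obtain ⟨x, hx⟩ := Multiset.lt_iff_cons_le.1 (hn.lt_of_ne (by rintro rfl; omega))
      exact hdown x n (ih m hm _ hx (by simp; omega))
  refine ⟨⟨0, h0⟩, fun m hm n hn => hlow (m.card - n.card) m hm n hn ?_, ?_⟩
  · have := Multiset.card_le_card hn
    omega
  · have hup2 : ∀ m ∈ Q, ∃ n ∈ I, m ≤ n ∧ n.card = 3 := fun m hm => by
      obtain ⟨x, hx⟩ := hQ.exists_cubic m hm
      exact ⟨_, h3 _ hx, Multiset.le_cons_self m x, hQ.card_cubic _ hx⟩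
    intro m hm
    rcases (hI _).1 hm with rfl | ⟨x, hx, rfl⟩ | h | h
    · obtain ⟨t, ht⟩ := hT
      exact ⟨t, h3 t ht, Multiset.zero_le t, hQ.card_cubic t ht⟩
    · obtain ⟨m, hm, hxm⟩ := hQ.exists_quadric x hx
      obtain ⟨n, hn, hmn, hc⟩ := hup2 m hm
      exact ⟨n, hn, (Multiset.singleton_le.2 hxm).trans hmn, hc⟩
    · exact hup2 m h
    · exact ⟨m, hm, le_rfl, hQ.card_cubic m h⟩

theorem CubicSystem.isPureOSequence {S : Finset ℕ} {Q T : Finset (Multiset ℕ)}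
    (hQ : CubicSystem S Q T) (hT : T.Nonempty) {H : ℕ → ℕ} (H₀ : H 0 = 1) (H₁ : H 1 = S.card)
    (H₂ : H 2 = Q.card) (H₃ : H 3 = T.card) (H₄ : ∀ i, 3 < i → H i = 0) :
    IsPureOSequence 3 H := by
  refine (hQ.isPureIdeal hT).isPureOSequence fun i => ?_
  have hS : ∀ m ∈ S.image fun x => ({x} : Multiset ℕ), m.card = 1 := by simp
  have key : ∀ j, ∀ A : Finset (Multiset ℕ), (∀ m ∈ A, m.card = j) →
      A.filter (fun m => m.card = i) = if i = j then A else ∅ := by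
    intro j A hA
    split_ifs with h
    · exact Finset.filter_true_of_mem fun m hm => by rw [hA m hm, h]
    · exact Finset.filter_false_of_mem fun m hm => by rw [hA m hm]; exact Ne.symm h
  rw [Finset.insert_eq, Finset.filter_union, Finset.filter_union, Finset.filter_union,
    key 0 {0} (by simp), key 1 _ hS, key 2 Q hQ.card_quadric, key 3 T hQ.card_cubic]
  rcases Nat.lt_or_ge 3 i with hi | hi
  · rw [H₄ i hi, if_neg (by omega), if_neg (by omega), if_neg (by omega), if_neg (by omega)]
    simp
  · interval_cases i
    · simp [H₀]
    · simp [H₁, Finset.card_image_of_injective S (fun _ _ => Multiset.singleton_inj.1 :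
        Function.Injective fun x : ℕ => ({x} : Multiset ℕ))]
    · simp [H₂]
    · simp [H₃]

/-! ### Partial cones over a graph -/

section

variable {α : Type*} [DecidableEq α]

theorem mem_of_mem_cubic {S : Finset α} {Q T : Finset (Multiset α)} (hQS : Q ⊆ monomialsOn S 2)
    (hTQ : ∀ x m, x ::ₘ m ∈ T → m ∈ Q) {t : Multiset α} (ht : t ∈ T) {x : α} (hx : x ∈ t) :
    x ∈ S := by
  obtain ⟨n, rfl⟩ := Multiset.exists_cons_of_mem hx
  obtain ⟨y, z, rfl⟩ := Multiset.card_eq_two.1 (mem_monomialsOn.1 (hQS (hTQ x n ht))).1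
  exact (mem_monomialsOn.1 (hQS (hTQ y (x ::ₘ {z}) (by rw [Multiset.cons_swap]; exact ht)))).2 x
    (Multiset.mem_cons_self x _)

/-- A partial cone with apex `z` over the graph `Q`: the apex is joined to itself and to `S'`,
and the new cubics are `z • K` and `z² • R`. -/
theorem cubicSystem_cone {S S' R : Finset α} {Q T K : Finset (Multiset α)} (z : α)
    (hS' : S' ⊆ S) (hQS : Q ⊆ monomialsOn S 2) (hT : ∀ t ∈ T, t.card = 3)
    (hTQ : ∀ x m, x ::ₘ m ∈ T → m ∈ Q) (hKQ : K ⊆ Q) (hKS : ∀ m ∈ K, ∀ x ∈ m, x ∈ S')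
    (hR : R ⊆ insert z S') (hRne : R.Nonempty) (hQc : ∀ m ∈ Q, m ∈ K ∨ ∃ x, x ::ₘ m ∈ T)
    (hSc' : ∀ x ∈ S', x ∈ R ∨ ∃ m ∈ K, x ∈ m) (hSc : ∀ x ∈ S, x ∈ S' ∨ ∃ m ∈ Q, x ∈ m) :
    CubicSystem (insert z S) (Q ∪ (insert z S').image fun x => z ::ₘ {x})
      (T ∪ (K.image (fun m => z ::ₘ m) ∪ R.image fun x => z ::ₘ z ::ₘ {x})) := by
  have hKc : ∀ m ∈ K, m.card = 2 := fun m hm => (mem_monomialsOn.1 (hQS (hKQ hm))).1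
  refine ⟨?_, ?_, ?_, ?_, ?_, ?_⟩
  · simp only [Finset.mem_union, Finset.mem_image]
    rintro t (ht | ⟨m, hm, rfl⟩ | ⟨x, -, rfl⟩)
    exacts [hT t ht, by simp [hKc m hm], by simp]
  · simp only [Finset.mem_union, Finset.mem_image]
    rintro m (hm | ⟨x, -, rfl⟩)
    exacts [(mem_monomialsOn.1 (hQS hm)).1, by simp]
  · simp only [Finset.mem_union, Finset.mem_image]
    rintro x m (hm | ⟨k, hk, hkm⟩ | ⟨r, hr, hrm⟩)
    · exact Or.inl (hTQ x m hm)
    · rcases Multiset.cons_eq_cons.1 hkm with ⟨rfl, rfl⟩ | ⟨-, c, rfl, rfl⟩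
      · exact Or.inl (hKQ hk)
      · obtain ⟨y, rfl⟩ := Multiset.card_eq_one.1 (by simpa using hKc _ hk)
        exact Or.inr ⟨y, Finset.mem_insert_of_mem (hKS _ hk y (by simp)), rfl⟩
    · rcases Multiset.cons_eq_cons.1 hrm with ⟨rfl, rfl⟩ | ⟨hne, c, hc, rfl⟩
      · exact Or.inr ⟨r, hR hr, rfl⟩
      · rcases Multiset.cons_eq_cons.1 hc with ⟨rfl, -⟩ | ⟨-, d, hd, rfl⟩
        · exact absurd rfl hne
        · obtain rfl : d = 0 := by simpa using congrArg Multiset.card hd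
          exact Or.inr ⟨z, Finset.mem_insert_self _ _, rfl⟩
  · simp only [Finset.mem_union, Finset.mem_image]
    rintro m (hm | ⟨y, hy, rfl⟩) x hx
    · exact Finset.mem_insert_of_mem ((mem_monomialsOn.1 (hQS hm)).2 x hx)
    · rcases Multiset.mem_cons.1 hx with rfl | hx
      · exact Finset.mem_insert_self _ _
      · rw [Multiset.mem_singleton.1 hx]
        exact Finset.insert_subset_insert z hS' hy
  · simp only [Finset.mem_union, Finset.mem_image]
    rintro m (hm | ⟨y, hy, rfl⟩)
    · rcases hQc m hm with h | ⟨x, hx⟩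
      · exact ⟨z, Or.inr (Or.inl ⟨m, h, rfl⟩)⟩
      · exact ⟨x, Or.inl hx⟩
    -- The quadric z² is always present, and only a cubic z²r can cover it; hence R must be
    -- nonempty.
    · rcases Finset.mem_insert.1 hy with rfl | hy
      · obtain ⟨r, hr⟩ := hRne
        exact ⟨r, Or.inr (Or.inr ⟨r, hr, by rw [cons_singleton_comm, Multiset.cons_swap]⟩)⟩
      · rcases hSc' y hy with h | ⟨m, hm, hym⟩
        · exact ⟨z, Or.inr (Or.inr ⟨y, h, rfl⟩)⟩
        · obtain ⟨x, rfl⟩ := eq_cons_cons_of_card_two (hKc m hm) hym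
          exact ⟨x, Or.inr (Or.inl ⟨_, hm, by rw [cons_singleton_comm, Multiset.cons_swap]⟩)⟩
  · intro x hx
    simp only [Finset.mem_union, Finset.mem_image]
    rcases Finset.mem_insert.1 hx with rfl | hx
    · exact ⟨x ::ₘ {x}, Or.inr ⟨x, Finset.mem_insert_self _ _, rfl⟩, by simp⟩
    · rcases hSc x hx with h | ⟨m, hm, hxm⟩
      · exact ⟨z ::ₘ {x}, Or.inr ⟨x, Finset.mem_insert_of_mem h, rfl⟩, by simp⟩
      · exact ⟨m, Or.inl hm, hxm⟩

theorem card_cone_quadrics {S S' : Finset α} {Q : Finset (Multiset α)} {z : α} (hz : z ∉ S)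
    (hS' : S' ⊆ S) (hQS : Q ⊆ monomialsOn S 2) :
    (Q ∪ (insert z S').image fun x => z ::ₘ {x}).card = Q.card + S'.card + 1 := by
  rw [Finset.card_union_of_disjoint, Finset.card_image_of_injective _ (cons_singleton_injective z),
    Finset.card_insert_of_notMem fun h => hz (hS' h), add_assoc]
  refine Finset.disjoint_left.2 fun m hm hm' => ?_
  obtain ⟨x, -, rfl⟩ := Finset.mem_image.1 hm'
  exact hz ((mem_monomialsOn.1 (hQS hm)).2 z (Multiset.mem_cons_self z _))

theorem card_cone_cubics {S R : Finset α} {Q T K : Finset (Multiset α)} {z : α} (hz : z ∉ S)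
    (hQS : Q ⊆ monomialsOn S 2) (hTQ : ∀ x m, x ::ₘ m ∈ T → m ∈ Q) (hKQ : K ⊆ Q) :
    (T ∪ (K.image (fun m => z ::ₘ m) ∪ R.image fun x => z ::ₘ z ::ₘ {x})).card =
      T.card + K.card + R.card := by
  have hcons : Function.Injective fun m : Multiset α => z ::ₘ m :=
    fun _ _ => (Multiset.cons_inj_right z).1
  rw [Finset.card_union_of_disjoint, Finset.card_union_of_disjoint,
    Finset.card_image_of_injective _ hcons,
    Finset.card_image_of_injective R (show Function.Injective fun x : α => z ::ₘ z ::ₘ {x} from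
      hcons.comp (cons_singleton_injective z)), add_assoc]
  · refine Finset.disjoint_left.2 fun m hm hm' => ?_
    obtain ⟨k, hk, rfl⟩ := Finset.mem_image.1 hm
    obtain ⟨x, -, hx⟩ := Finset.mem_image.1 hm'
    rw [Multiset.cons_inj_right] at hx
    exact hz ((mem_monomialsOn.1 (hQS (hKQ hk))).2 z (hx ▸ Multiset.mem_cons_self z _))
  · refine Finset.disjoint_left.2 fun m hm hm' => hz (mem_of_mem_cubic hQS hTQ hm ?_)
    simp only [Finset.mem_union, Finset.mem_image] at hm'
    rcases hm' with ⟨k, -, rfl⟩ | ⟨x, -, rfl⟩ <;> exact Multiset.mem_cons_self z _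

end

theorem isPureOSequence_cone {S S' R : Finset ℕ} {Q T K : Finset (Multiset ℕ)} {z : ℕ} (hz : z ∉ S)
    (hS' : S' ⊆ S) (hQS : Q ⊆ monomialsOn S 2) (hT : ∀ t ∈ T, t.card = 3)
    (hTQ : ∀ x m, x ::ₘ m ∈ T → m ∈ Q) (hKQ : K ⊆ Q) (hKS : ∀ m ∈ K, ∀ x ∈ m, x ∈ S')
    (hR : R ⊆ insert z S') (hRne : R.Nonempty) (hQc : ∀ m ∈ Q, m ∈ K ∨ ∃ x, x ::ₘ m ∈ T)
    (hSc' : ∀ x ∈ S', x ∈ R ∨ ∃ m ∈ K, x ∈ m) (hSc : ∀ x ∈ S, x ∈ S' ∨ ∃ m ∈ Q, x ∈ m)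
    {H : ℕ → ℕ} (H₀ : H 0 = 1) (H₁ : H 1 = S.card + 1) (H₂ : H 2 = Q.card + S'.card + 1)
    (H₃ : H 3 = T.card + K.card + R.card) (H₄ : ∀ i, 3 < i → H i = 0) :
    IsPureOSequence 3 H := by
  refine (cubicSystem_cone z hS' hQS hT hTQ hKQ hKS hR hRne hQc hSc' hSc).isPureOSequence ?_ H₀
    (by rw [H₁, Finset.card_insert_of_notMem hz]) (by rw [H₂, card_cone_quadrics hz hS' hQS])
    (by rw [H₃, card_cone_cubics hz hQS hTQ hKQ]) H₄
  obtain ⟨r, hr⟩ := hRne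
  exact ⟨_, Finset.mem_union_right _ (Finset.mem_union_right _ (Finset.mem_image_of_mem _ hr))⟩

/-! ### Shifted sums in socle degree three -/

/-- Here n counts the new quadrics other than z². A pair u, v is covered by the single cubic zuv and
uses zu, zv, and also uv when it is not yet in Q: two or three quadrics per cubic. The fewer than
three left over are zx, covered by z²x. The maximum reserves one cubic to cover z². -/
theorem exists_pairing {α : Type*} [DecidableEq α] (Q : Finset (Multiset α)) (n : ℕ)
    (S : Finset α) (hn : n ≤ S.card) :
    ∃ S' ⊆ S, ∃ K ⊆ monomialsOn S' 2, ∃ R ⊆ S', S'.card + (K \ Q).card = n ∧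
      (∀ x ∈ S', x ∈ R ∨ ∃ m ∈ K, x ∈ m) ∧ 2 * (K.card + max R.card 1) ≤ n + 2 := by
  induction n using Nat.strong_induction_on generalizing S with
  | _ n ih =>
    rcases Nat.lt_or_ge n 3 with h3 | h3
    · obtain ⟨S', hS', hc⟩ := Finset.exists_subset_card_eq hn
      refine ⟨S', hS', ∅, Finset.empty_subset _, S', subset_rfl, by simpa using hc,
        fun x hx => Or.inl hx, ?_⟩
      rw [hc]
      interval_cases n <;> simp
    obtain ⟨u, hu, v, hv, huv⟩ := Finset.one_lt_card.1 (show 1 < S.card by omega)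
    have hSc : ((S.erase u).erase v).card = S.card - 2 := by
      rw [Finset.card_erase_of_mem (Finset.mem_erase.2 ⟨huv.symm, hv⟩),
        Finset.card_erase_of_mem hu]; omega
    obtain ⟨k, hk, hk2⟩ : ∃ k, (k = if u ::ₘ {v} ∈ Q then 2 else 3) ∧ 2 ≤ k ∧ k ≤ 3 := by
      split_ifs <;> exact ⟨_, rfl, by omega⟩
    obtain ⟨S', hS', K, hK, R, hR, hc, hcov, hle⟩ :=
      ih (n - k) (by omega) ((S.erase u).erase v) (by omega)
    have huS' : u ∉ S' := fun h => by simpa using hS' h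
    have hvS' : v ∉ S' := fun h => by simpa using hS' h
    have hKn : u ::ₘ {v} ∉ K := fun h => huS' ((mem_monomialsOn.1 (hK h)).2 u (by simp))
    refine ⟨insert u (insert v S'), ?_, insert (u ::ₘ {v}) K, ?_, R,
      hR.trans ((Finset.subset_insert _ _).trans (Finset.subset_insert _ _)), ?_, ?_, ?_⟩
    · refine Finset.insert_subset hu (Finset.insert_subset hv (hS'.trans ?_))
      exact (Finset.erase_subset _ _).trans (Finset.erase_subset _ _)
    · refine Finset.insert_subset (mem_monomialsOn.2 ⟨by simp, by simp⟩) fun m hm => ?_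
      obtain ⟨h1, h2⟩ := mem_monomialsOn.1 (hK hm)
      exact mem_monomialsOn.2 ⟨h1, fun x hx =>
        Finset.mem_insert_of_mem (Finset.mem_insert_of_mem (h2 x hx))⟩
    · rw [Finset.card_insert_of_notMem (by simp [huv, huS']), Finset.card_insert_of_notMem hvS']
      by_cases hQ : u ::ₘ {v} ∈ Q
      · rw [Finset.insert_sdiff_of_mem _ hQ]
        rw [if_pos hQ] at hk
        omega
      · rw [Finset.insert_sdiff_of_notMem _ hQ, Finset.card_insert_of_notMem fun h =>
          hKn (Finset.mem_sdiff.1 h).1]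
        rw [if_neg hQ] at hk
        omega
    · intro x hx
      simp only [Finset.mem_insert] at hx
      rcases hx with rfl | rfl | hx
      · exact Or.inr ⟨_, Finset.mem_insert_self _ _, by simp⟩
      · exact Or.inr ⟨_, Finset.mem_insert_self _ _, by simp⟩
      · rcases hcov x hx with h | ⟨m, hm, hxm⟩
        · exact Or.inl h
        · exact Or.inr ⟨m, Finset.mem_insert_of_mem hm, hxm⟩
    · rw [Finset.card_insert_of_notMem hKn]
      omega

/-- The quotients of the members of `T` by one variable. -/
def lowerShadow {α : Type*} [DecidableEq α] (T : Finset (Multiset α)) : Finset (Multiset α) :=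
  T.biUnion fun t => t.toFinset.image t.erase

theorem mem_lowerShadow {α : Type*} [DecidableEq α] {T : Finset (Multiset α)} {m : Multiset α} :
    m ∈ lowerShadow T ↔ ∃ x, x ::ₘ m ∈ T := by
  simp only [lowerShadow, Finset.mem_biUnion, Finset.mem_image, Multiset.mem_toFinset]
  constructor
  · rintro ⟨t, ht, x, hx, rfl⟩
    exact ⟨x, by rwa [Multiset.cons_erase hx]⟩
  · rintro ⟨x, hx⟩
    exact ⟨_, hx, x, Multiset.mem_cons_self x m, Multiset.erase_cons_head x m⟩

theorem card_lowerShadow_insert_le {α : Type*} [DecidableEq α] (T : Finset (Multiset α))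
    (t : Multiset α) : (lowerShadow (insert t T)).card ≤ (lowerShadow T).card + t.card := by
  rw [lowerShadow, Finset.biUnion_insert, ← lowerShadow, add_comm]
  exact (Finset.card_union_le _ _).trans (Nat.add_le_add_right
    (Finset.card_image_le.trans (Multiset.toFinset_card_le t)) _)

/-- Adding a cubic raises (shadow size) − (number of cubics) by at most two. On the way from 0 to a
value at least N, this difference therefore hits N or N − 1. -/
theorem exists_subset_card_lowerShadow {α : Type*} [DecidableEq α] (T : Finset (Multiset α))
    (hT : ∀ t ∈ T, t.card = 3) {N : ℕ} (hN : N + T.card ≤ (lowerShadow T).card) :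
    ∃ T' ⊆ T, (lowerShadow T').card = N + T'.card ∨ (lowerShadow T').card + 1 = N + T'.card := by
  induction T using Finset.induction_on with
  | empty => exact ⟨∅, subset_rfl, Or.inl (by simp [lowerShadow] at hN ⊢; omega)⟩
  | insert t T ht ih =>
    have h3 := hT t (Finset.mem_insert_self t T)
    have hle := card_lowerShadow_insert_le T t
    have hc := Finset.card_insert_of_notMem ht
    by_cases hNT : N + T.card ≤ (lowerShadow T).card
    · obtain ⟨T', hT', h⟩ := ih (fun t ht => hT t (Finset.mem_insert_of_mem ht)) hNT
      exact ⟨T', hT'.trans (Finset.subset_insert t T), h⟩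
    · by_cases h : (lowerShadow T).card + 1 = N + T.card
      · exact ⟨T, Finset.subset_insert t T, Or.inr h⟩
      · exact ⟨insert t T, subset_rfl, Or.inl (by omega)⟩

/-! ### The three cases for p and q -/

namespace CubicSystem

variable {S : Finset ℕ} {Q T : Finset (Multiset ℕ)}

theorem quadrics_subset (hQ : CubicSystem S Q T) : Q ⊆ monomialsOn S 2 := fun m hm =>
  mem_monomialsOn.2 ⟨hQ.card_quadric m hm, hQ.mem_vars m hm⟩

theorem card_quadrics_le (hQ : CubicSystem S Q T) : Q.card ≤ (S.card + 1).choose 2 := by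
  rw [← card_monomialsOn_two]
  exact Finset.card_le_card hQ.quadrics_subset

theorem lowerShadow_eq (hQ : CubicSystem S Q T) : lowerShadow T = Q := by
  ext m
  rw [mem_lowerShadow]
  exact ⟨fun ⟨x, hx⟩ => hQ.mem_quadrics x m hx, hQ.exists_cubic m⟩

/-- Q and T are kept. By `exists_pairing` a cone adding p quadrics needs at most ⌈p/2⌉ ≤ q cubics,
and enlarging R by further z²x reaches q because q ≤ p. -/
theorem isPureOSequence_of_le (hQ : CubicSystem S Q T) {p q : ℕ} (hp : 1 ≤ p) (hpS : p ≤ S.card)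
    (hpq : p ≤ 2 * q) (hqp : q ≤ p) {H : ℕ → ℕ} (H₀ : H 0 = 1) (H₁ : H 1 = S.card + 1)
    (H₂ : H 2 = Q.card + p) (H₃ : H 3 = T.card + q) (H₄ : ∀ i, 3 < i → H i = 0) :
    IsPureOSequence 3 H := by
  obtain ⟨z, hz⟩ := Infinite.exists_notMem_finset S
  obtain ⟨S', hS', K, hK, R₀, hR₀, hc, hcov, hle⟩ := exists_pairing Q (p - 1) S (by omega)
  obtain ⟨R₁, hR₀₁, hR₁, hR₁c⟩ : ∃ R₁, R₀ ⊆ R₁ ∧ R₁ ⊆ insert z S' ∧ R₁.card = max R₀.card 1 := by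
    rcases R₀.eq_empty_or_nonempty with rfl | h
    · exact ⟨{z}, by simp, by simp, by simp⟩
    · exact ⟨R₀, subset_rfl, hR₀.trans (Finset.subset_insert z S'),
        (max_eq_left (Finset.card_pos.2 h)).symm⟩
  have hins : (insert z S').card = S'.card + 1 := Finset.card_insert_of_notMem fun h => hz (hS' h)
  have hKQ : (K \ Q).card ≤ K.card := Finset.card_le_card Finset.sdiff_subset
  obtain ⟨R, hR₁R, hR, hRc⟩ := Finset.exists_subsuperset_card_eq (n := q - K.card) hR₁
    (by omega) (by omega)
  have hRpos : R.Nonempty := Finset.card_pos.1 (by omega)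
  refine isPureOSequence_cone (S := S) (S' := S') (R := R) (Q := Q ∪ K) (T := T) (K := K) hz hS' ?_
    hQ.card_cubic (fun x m hm => Finset.mem_union_left _ (hQ.mem_quadrics x m hm))
    Finset.subset_union_right (fun m hm => (mem_monomialsOn.1 (hK hm)).2) hR hRpos ?_ ?_ ?_
    H₀ H₁ ?_ ?_ H₄
  · refine Finset.union_subset hQ.quadrics_subset fun m hm => ?_
    obtain ⟨h1, h2⟩ := mem_monomialsOn.1 (hK hm)
    exact mem_monomialsOn.2 ⟨h1, fun x hx => hS' (h2 x hx)⟩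
  · intro m hm
    rcases Finset.mem_union.1 hm with h | h
    exacts [Or.inr (hQ.exists_cubic m h), Or.inl h]
  · exact fun x hx => (hcov x hx).imp_left fun h => hR₁R (hR₀₁ h)
  · intro x hx
    obtain ⟨m, hm, hxm⟩ := hQ.exists_quadric x hx
    exact Or.inr ⟨m, Finset.mem_union_left _ hm, hxm⟩
  · rw [H₂, ← Finset.union_sdiff_self_eq_union, Finset.card_union_of_disjoint
      Finset.disjoint_sdiff]
    omega
  · omega

/-- A cone with K = D and R = S' ∪ {z} adds as many quadrics as cubics: m in D is matched with zm,
and zx with z²x. So T' is chosen to have already the required excess N of quadrics over cubics, up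
to one. Variables U exposed by the deletion go into S'; Hall's condition shows that enough quadrics
were freed. -/
theorem isPureOSequence_of_lt (hQ : CubicSystem S Q T) {p q : ℕ} (hp : 1 ≤ p) (hpS : p ≤ S.card)
    (hpq : p < q) (hle : T.card + q ≤ Q.card + p) {H : ℕ → ℕ} (H₀ : H 0 = 1)
    (H₁ : H 1 = S.card + 1) (H₂ : H 2 = Q.card + p) (H₃ : H 3 = T.card + q)
    (H₄ : ∀ i, 3 < i → H i = 0) : IsPureOSequence 3 H := by
  obtain ⟨z, hz⟩ := Infinite.exists_notMem_finset S
  obtain ⟨T', hT', hT'c⟩ := exists_subset_card_lowerShadow T hQ.card_cubic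
    (N := Q.card + p - (T.card + q)) (by rw [hQ.lowerShadow_eq]; omega)
  set Q' := lowerShadow T' with hQ'
  have hT'T := Finset.card_le_card hT'
  have hQ'Q : Q' ⊆ Q := fun m hm => by
    obtain ⟨x, hx⟩ := mem_lowerShadow.1 hm
    exact hQ.mem_quadrics x m (hT' hx)
  have hQ'c := Finset.card_le_card hQ'Q
  set U := S.filter fun x => ∀ m ∈ Q', x ∉ m with hU
  have hUS : U ⊆ S := Finset.filter_subset _ _
  have hUc : U.card + Q'.card ≤ Q.card := by
    have h1 := hQ.card_le_touching hUS
    have h2 : Disjoint (touching Q U) Q' := Finset.disjoint_left.2 fun m hm hm' => by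
      obtain ⟨-, x, hx, hxU⟩ := mem_touching.1 hm
      exact (Finset.mem_filter.1 hxU).2 m hm' hx
    have h3 := Finset.card_le_card (Finset.union_subset (touching_subset Q U) hQ'Q)
    rw [Finset.card_union_of_disjoint h2] at h3
    omega
  have hUS' := Finset.card_le_card hUS
  -- Besides z², there are |Q| − |Q'| + p − 1 quadrics to add. They are used for zx with x in S' as
  -- far as S allows, and the surplus becomes D.
  obtain ⟨S', hUS', hS', hS'c⟩ := Finset.exists_subsuperset_card_eq
    (n := min S.card (Q.card - Q'.card + p - 1)) hUS (by omega) (by omega)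
  obtain ⟨D, hD, hDc⟩ : ∃ D ⊆ monomialsOn S' 2 \ Q',
      D.card = Q.card - Q'.card + p - 1 - S'.card := by
    rcases Nat.le_total S.card (Q.card - Q'.card + p - 1) with h | h
    · obtain rfl : S' = S := Finset.eq_of_subset_of_card_le hS' (by omega)
      refine Finset.exists_subset_card_eq ?_
      have h1 := Finset.le_card_sdiff Q' (monomialsOn S' 2)
      rw [card_monomialsOn_two] at h1
      have h2 := hQ.card_quadrics_le
      omega
    · exact ⟨∅, Finset.empty_subset _, by simp; omega⟩
  have hDS : ∀ m ∈ D, m.card = 2 ∧ ∀ x ∈ m, x ∈ S' := fun m hm =>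
    mem_monomialsOn.1 (Finset.mem_sdiff.1 (hD hm)).1
  have hdisj : Disjoint Q' D := Finset.disjoint_right.2 fun m hm =>
    (Finset.mem_sdiff.1 (hD hm)).2
  have hins : (insert z S').card = S'.card + 1 := Finset.card_insert_of_notMem fun h => hz (hS' h)
  -- If the excess of T' is N − 1 rather than N, leaving out z³ corrects it.
  obtain ⟨R, hS'R, hR, hRpos, hRc⟩ : ∃ R, S' ⊆ R ∧ R ⊆ insert z S' ∧ R.Nonempty ∧
      T'.card + D.card + R.card = T.card + q := by
    rcases hT'c with h | h
    · exact ⟨insert z S', Finset.subset_insert z S', subset_rfl, Finset.insert_nonempty z S',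
        by omega⟩
    · exact ⟨S', subset_rfl, Finset.subset_insert z S', Finset.card_pos.1 (by omega), by omega⟩
  refine isPureOSequence_cone (S := S) (S' := S') (R := R) (Q := Q' ∪ D) (T := T') (K := D) hz hS' ?_
    (fun t ht => hQ.card_cubic t (hT' ht))
    (fun x m hm => Finset.mem_union_left _ (mem_lowerShadow.2 ⟨x, hm⟩)) Finset.subset_union_right
    (fun m hm => (hDS m hm).2) hR hRpos ?_ (fun x hx => Or.inl (hS'R hx)) ?_ H₀ H₁ ?_ ?_ H₄
  · exact Finset.union_subset (hQ'Q.trans hQ.quadrics_subset) fun m hm =>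
      mem_monomialsOn.2 ⟨(hDS m hm).1, fun x hx => hS' ((hDS m hm).2 x hx)⟩
  · intro m hm
    rcases Finset.mem_union.1 hm with h | h
    exacts [Or.inr (mem_lowerShadow.1 h), Or.inl h]
  · intro x hx
    by_cases hxU : x ∈ U
    · exact Or.inl (hUS' hxU)
    · have : ∃ m ∈ Q', x ∈ m := by
        by_contra! h
        exact hxU (Finset.mem_filter.2 ⟨hx, h⟩)
      obtain ⟨m, hm, hxm⟩ := this
      exact Or.inr ⟨m, Finset.mem_union_left _ hm, hxm⟩
  · rw [H₂, Finset.card_union_of_disjoint hdisj]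
    omega
  · rw [H₃, hRc]

/-- The full cone over a graph F with |Q| − |S| + p − 1 edges has |Q| + p quadrics and as many
cubics divisible by z. The other cubics fit over F, since |T| ≤ |Q| + (|Q| − |S|)^{<2} and q − p is
absorbed by p − 1 steps of Macaulay growth. -/
theorem isPureOSequence_of_ge (hQ : CubicSystem S Q T) {p q : ℕ} (hp : 1 ≤ p) (hpS : p ≤ S.card)
    (hpq : p ≤ q) (hqp : q ≤ (p + 1).choose 2) (hΔ : q + S.card ≤ Q.card + p)
    (hge : Q.card + p ≤ T.card + q) {H : ℕ → ℕ} (H₀ : H 0 = 1)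
    (H₁ : H 1 = S.card + 1) (H₂ : H 2 = Q.card + p) (H₃ : H 3 = T.card + q)
    (H₄ : ∀ i, 3 < i → H i = 0) : IsPureOSequence 3 H := by
  obtain ⟨z, hz⟩ := Infinite.exists_notMem_finset S
  obtain ⟨d, rfl⟩ : ∃ d, p = d + 1 := ⟨p - 1, by omega⟩
  have hd := choose_succ_two d
  have hd' : (d + 1 + 1).choose 2 = (d + 1).choose 2 + (d + 1) := hd
  have hbound := hQ.card_cubics_le
  have hgrow := macaulayGrowth_add_le (m := Q.card - S.card) (d := d) (x := q - (d + 1))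
    (by omega) (by omega)
  have hQc := hQ.card_quadrics_le
  obtain ⟨F, hF, T', hFc, hT'c, hT', hT'F⟩ :=
    exists_macaulay_graph (S := S) (m := Q.card - S.card + d) (by omega)
  obtain ⟨T₀, hT₀, hT₀c⟩ := Finset.exists_subset_card_eq
    (show T.card + q - (Q.card + (d + 1)) ≤ T'.card by omega)
  have hins : (insert z S).card = S.card + 1 := Finset.card_insert_of_notMem hz
  refine isPureOSequence_cone (S := S) (S' := S) (R := insert z S) (Q := F) (T := T₀) (K := F) hz
    subset_rfl hF (fun t ht => hT' t (hT₀ ht)) (fun x m hm => hT'F x m (hT₀ hm)) subset_rfl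
    (fun m hm => (mem_monomialsOn.1 (hF hm)).2) subset_rfl (Finset.insert_nonempty z S)
    (fun m hm => Or.inl hm) (fun x hx => Or.inl (Finset.mem_insert_of_mem hx))
    (fun x hx => Or.inl hx) H₀ H₁ ?_ ?_ H₄
  · omega
  · omega

end CubicSystem

/-! ### Numerical constraints on pure ideals, and the cases e = 1, 2, 3 -/

namespace IsPureIdeal

variable {α : Type*} {e : ℕ} {I : Finset (Multiset α)}

theorem card_filter_zero (hI : IsPureIdeal e I) : (I.filter fun m => m.card = 0).card = 1 := by
  refine Finset.card_eq_one.2 ⟨0, Finset.ext fun m => ?_⟩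
  simp only [Finset.mem_filter, Multiset.card_eq_zero, Finset.mem_singleton]
  exact ⟨fun h => h.2, fun h => ⟨h ▸ hI.zero_mem, h⟩⟩

theorem card_filter_of_lt (hI : IsPureIdeal e I) {i : ℕ} (hi : e < i) :
    (I.filter fun m => m.card = i).card = 0 := by
  refine Finset.card_eq_zero.2 (Finset.filter_false_of_mem fun m hm => ?_)
  have := hI.card_le hm
  omega

theorem one_le_card_filter_one (hI : IsPureIdeal e I) (he : 1 ≤ e) :
    1 ≤ (I.filter fun m => m.card = 1).card := by
  obtain ⟨n, hn, -, hc⟩ := hI.exists_ge 0 hI.zero_mem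
  obtain ⟨x, hx⟩ := Multiset.card_pos_iff_exists_mem.1 (show 0 < n.card by omega)
  exact Finset.card_pos.2 ⟨{x}, Finset.mem_filter.2
    ⟨hI.mem_of_le n hn _ (Multiset.singleton_le.2 hx), by simp⟩⟩

variable [DecidableEq α]

theorem card_filter_one (hI : IsPureIdeal e I) :
    (I.filter fun m => m.card = 1).card = (I.sup fun m => m.toFinset).card := by
  rw [← Finset.card_image_of_injective (I.sup fun m => m.toFinset)
    (fun _ _ => Multiset.singleton_inj.1 : Function.Injective fun x : α => ({x} : Multiset α))]
  congr 1
  ext m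
  simp only [Finset.mem_image, Finset.mem_filter, Finset.mem_sup, Multiset.mem_toFinset]
  constructor
  · rintro ⟨hm, hc⟩
    obtain ⟨x, rfl⟩ := Multiset.card_eq_one.1 hc
    exact ⟨x, ⟨_, hm, by simp⟩, rfl⟩
  · rintro ⟨x, ⟨m, hm, hx⟩, rfl⟩
    exact ⟨hI.mem_of_le m hm _ (Multiset.singleton_le.2 hx), by simp⟩

theorem card_filter_two_le (hI : IsPureIdeal e I) : (I.filter fun m => m.card = 2).card ≤
    ((I.filter fun m => m.card = 1).card + 1).choose 2 := by
  rw [hI.card_filter_one, ← card_monomialsOn_two]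
  refine Finset.card_le_card fun m hm => ?_
  obtain ⟨hm, hc⟩ := Finset.mem_filter.1 hm
  exact mem_monomialsOn.2 ⟨hc, fun x hx => Finset.mem_sup.2 ⟨m, hm, Multiset.mem_toFinset.2 hx⟩⟩

/-- Every variable divides a monomial of degree e, which involves at most e variables. For e = 2
this is p ≤ 2q. -/
theorem card_filter_one_le_mul (hI : IsPureIdeal e I) : (I.filter fun m => m.card = 1).card ≤
    e * (I.filter fun m => m.card = e).card := by
  rw [hI.card_filter_one, mul_comm]
  refine (Finset.card_le_card fun x hx => ?_).trans (Finset.card_biUnion_le_card_mul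
    (I.filter fun m => m.card = e) (fun m => m.toFinset) e fun m hm =>
      (Multiset.toFinset_card_le m).trans (Finset.mem_filter.1 hm).2.le)
  obtain ⟨m, hm, hxm⟩ := Finset.mem_sup.1 hx
  obtain ⟨n, hn, hmn, hc⟩ := hI.exists_ge m hm
  exact Finset.mem_biUnion.2 ⟨n, Finset.mem_filter.2 ⟨hn, hc⟩,
    Multiset.mem_toFinset.2 (Multiset.mem_of_le hmn (Multiset.mem_toFinset.1 hxm))⟩

end IsPureIdeal

/-- The pure order ideal of socle degree one on a nonempty set of variables. -/
theorem isPureIdeal_one {α : Type*} [DecidableEq α] {S : Finset α} (hS : S.Nonempty) :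
    IsPureIdeal 1 (insert 0 (S.image fun x => ({x} : Multiset α))) := by
  obtain ⟨s, hs⟩ := hS
  refine ⟨Finset.insert_nonempty _ _, fun m hm n hn => ?_, fun m hm => ?_⟩
  · rcases Finset.mem_insert.1 hm with rfl | hm
    · rw [Multiset.le_zero.1 hn]; exact Finset.mem_insert_self _ _
    · obtain ⟨x, hx, rfl⟩ := Finset.mem_image.1 hm
      rcases Multiset.le_singleton.1 hn with rfl | rfl
      exacts [Finset.mem_insert_self _ _, Finset.mem_insert_of_mem hm]
  · rcases Finset.mem_insert.1 hm with rfl | hm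
    · exact ⟨{s}, Finset.mem_insert_of_mem (Finset.mem_image_of_mem _ hs), Multiset.zero_le _,
        by simp⟩
    · obtain ⟨x, hx, rfl⟩ := Finset.mem_image.1 hm
      exact ⟨{x}, Finset.mem_insert_of_mem hm, le_rfl, by simp⟩

theorem isPureOSequence_shiftedSum_one {h h' : ℕ → ℕ} (hh : IsPureOSequence 1 h)
    (hh' : IsPureOSequence 0 h') : IsPureOSequence 1 (shiftedSum h h') := by
  obtain ⟨I, hI, hIh⟩ := hh.exists_pureIdeal
  obtain ⟨J, hJ, hJh⟩ := hh'.exists_pureIdeal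
  refine isPureOSequence_shiftedSum hI hJ (fun m hm => ?_) hIh hJh
  rw [Multiset.card_eq_zero.1 (Nat.le_zero.1 (hJ.card_le hm))]
  exact hI.zero_mem

theorem isPureOSequence_shiftedSum_two {h h' : ℕ → ℕ} (hh : IsPureOSequence 2 h)
    (hh' : IsPureOSequence 1 h') (hle : h' 1 ≤ h 1) : IsPureOSequence 2 (shiftedSum h h') := by
  obtain ⟨I, hI, hIh⟩ := hh.exists_pureIdeal
  obtain ⟨J, hJ, hJh⟩ := hh'.exists_pureIdeal
  rw [hIh, hI.card_filter_one] at hle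
  obtain ⟨S, hS, hSc⟩ := Finset.exists_subset_card_eq hle
  have hSpos : S.Nonempty := by
    rw [← Finset.card_pos, hSc, hJh]
    exact hJ.one_le_card_filter_one le_rfl
  have hJ' := isPureIdeal_one hSpos
  refine isPureOSequence_shiftedSum hI hJ' (Finset.insert_subset hI.zero_mem fun m hm => ?_) hIh
    fun i => ?_
  · obtain ⟨x, hx, rfl⟩ := Finset.mem_image.1 hm
    obtain ⟨m, hm, hxm⟩ := Finset.mem_sup.1 (hS hx)
    exact hI.mem_of_le m hm _ (Multiset.singleton_le.2 (Multiset.mem_toFinset.1 hxm))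
  · rcases i with _ | _ | i
    · rw [hJh, hJ.card_filter_zero, hJ'.card_filter_zero]
    · rw [← hSc, Finset.filter_insert, if_neg (by simp), Finset.filter_true_of_mem (by simp),
        Finset.card_image_of_injective _ fun _ _ => Multiset.singleton_inj.1]
    · rw [hJh, hJ.card_filter_of_lt (by omega), hJ'.card_filter_of_lt (by omega)]

theorem isPureOSequence_shiftedSum_three {h h' : ℕ → ℕ} (hh : IsPureOSequence 3 h)
    (hh' : IsPureOSequence 2 h') (h₁ : h' 1 ≤ h 1) (h₂ : h' 2 + h 1 ≤ h 2 + h' 1) :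
    IsPureOSequence 3 (shiftedSum h h') := by
  obtain ⟨I, hI, hIh⟩ := hh.exists_pureIdeal
  obtain ⟨J, hJ, hJh⟩ := hh'.exists_pureIdeal
  obtain ⟨S, hQ, hS⟩ := hI.exists_cubicSystem
  have hp : 1 ≤ h' 1 := hJh 1 ▸ hJ.one_le_card_filter_one (by norm_num)
  have hpq : h' 1 ≤ 2 * h' 2 := by rw [hJh, hJh]; exact hJ.card_filter_one_le_mul
  have hqp : h' 2 ≤ (h' 1 + 1).choose 2 := by rw [hJh, hJh]; exact hJ.card_filter_two_le
  have hS1 : h 1 = S.card := by rw [hIh, hS]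
  have hQ2 := hIh 2
  have hT3 := hIh 3
  have H₀ : shiftedSum h h' 0 = 1 := (hIh 0).trans hI.card_filter_zero
  have H₁ : shiftedSum h h' 1 = S.card + 1 := by
    rw [← hS1, shiftedSum, hJh 0, hJ.card_filter_zero]
  have H₂ : shiftedSum h h' 2 = (I.filter fun m => m.card = 2).card + h' 1 := by
    rw [shiftedSum, hQ2]
  have H₃ : shiftedSum h h' 3 = (I.filter fun m => m.card = 3).card + h' 2 := by
    rw [shiftedSum, hT3]
  have H₄ : ∀ i, 3 < i → shiftedSum h h' i = 0 := fun i hi => by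
    obtain ⟨i, rfl⟩ : ∃ j, i = j + 1 := ⟨i - 1, by omega⟩
    rw [shiftedSum, hIh, hJh, hI.card_filter_of_lt hi, hJ.card_filter_of_lt (by omega)]
  rcases Nat.lt_or_ge (h' 1) (h' 2) with hlt | hge
  · rcases Nat.le_total (h 3 + h' 2) (h 2 + h' 1) with hc | hc
    · exact hQ.isPureOSequence_of_lt hp (by omega) hlt (by omega) H₀ H₁ H₂ H₃ H₄
    · exact hQ.isPureOSequence_of_ge hp (by omega) hlt.le hqp (by omega) (by omega) H₀ H₁ H₂ H₃ H₄
  · exact hQ.isPureOSequence_of_le hp (by omega) hpq hge H₀ H₁ H₂ H₃ H₄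

theorem theorem2 (e : ℕ) (he₁ : 1 ≤ e) (he₃ : e ≤ 3) (h h' : ℕ → ℕ)
    (hh : IsPureOSequence e h) (hh' : IsPureOSequence (e - 1) h')
    (hΔ : ∀ i : ℕ, i ≤ ⌈(e : ℚ) / 2⌉₊ → firstDifference h' i ≤ firstDifference h i)
    (hle : ∀ i : ℕ, i ≤ e - 1 → h' i ≤ h i) :
    IsPureOSequence e (shiftedSum h h') := by
  interval_cases e
  · exact isPureOSequence_shiftedSum_one hh hh'
  · exact isPureOSequence_shiftedSum_two hh hh' (hle 1 le_rfl)
  -- Since ⌈3/2⌉ = 2, the comparison of first differences reaches i = 2, which gives q − p ≤ |Q| −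
  -- |S|.
  · have h2 : 2 ≤ ⌈((3 : ℕ) : ℚ) / 2⌉₊ := Nat.add_one_le_ceil_iff.2 (by norm_num)
    have := hΔ 2 h2
    change (h' 2 : ℤ) - h' 1 ≤ h 2 - h 1 at this
    exact isPureOSequence_shiftedSum_three hh hh' (hle 1 (by norm_num)) (by omega)
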